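/- Let $p$ be an odd prime. For $x\in\mathbb Z_p^\times$ let $\omega(x)\in\mathbb C_p$ be the $(p-1)$-st root of unity with $\omega(x)\equiv x \bmod p$, let $\langle x\rangle=x/\omega(x)$, and put $\langle x\rangle^s=\exp_p(s\log_p\langle x\rangle)$ for $s\in\mathbb C_p$ with $|s|<p^{(p-2)/(p-1)}$. For $i\in\mathbb Z/(p-1)\mathbb Z$ and $s\ne1$ in this disc, the $p$-adic zeta function $\zeta_{p,i}(s)=L_p(s,\omega^{1-i})$ is defined by the Volkenborn integral $$\zeta_{p,i}(s)=\frac{(-1)^{i-1}}{s-1}\int_{\mathbb Z_p^\times}\omega(x)^{1-i}\langle x\rangle^{1-s}\,dx=\frac{(-1)^{i-1}}{s-1}\lim_{n\to\infty}\frac1{p^n}\sum_{0\le m<p^n,\ p\nmid m}\omega(m)^{1-i}\langle m\rangle^{1-s},$$ and $\zeta_{p,i}(1)=\lim_{s\to1}\zeta_{p,i}(s)$ if $i\neq 1$. (1) Let $\mu_1$ be the Bernoulli distribution on $\mathbb Z_p$, $\mu_1(a+p^n\mathbb Z_p)=\frac a{p^n}-\frac12$ for $0\le a<p^n$, and let $\mu(V)=\mu_1(V)-2\mu_1(\frac12V)$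 for clopen $V\subset\mathbb Z_p$. Then $\mu$ is a $\mathbb C_p$-valued measure on the algebra of clopen sets (additive, bounded, continuous) and $\mu(a+p^n\mathbb Z_p)=\frac{(-1)^a}2$ for $0\le a<p^n$. (2) Consider nonstandard extensions given by an ultrapower with respect to any ultrafilter. Let $N\in{}^*\mathbb N$ be infinite, $Y={}^*\mathbb Z_p/p^N\,{}^*\mathbb Z_p$, $Y^\times=({}^*\mathbb Z_p/p^N\,{}^*\mathbb Z_p)^\times$, let $\mathrm{st}_Y:Y\to\mathbb Z_p$ be the standard-part map, and let $\nu$ be the internal measure on the internal subsets of $Y$ with $\nu(\{a+p^N\,{}^*\mathbb Z_p\})=\frac{(-1)^a}2$ for $0\le a<p^N$. Then $(\mathbb Z_p,\mu)$ is the push-down of $(Y,\nu)$ via $\mathrm{st}_Y$: a set $V\subset\mathbb Z_p$ is clopen if and only if $\mathrm{st}_Y^{-1}(V)$ is internal, and in that case $\nu(\mathrm{st}_Y^{-1}(V))=\mu(V)$. (3) Let $i\in\mathbb Z/(p-1)\mathbb Z$ and $|s|<p^{(p-2)/(p-1)}$, and assume $s\ne1$ or $\omega(2)^{1-i}\neq1$.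 Put $D=1-\omega(2)^{1-i}\langle2\rangle^{1-s}$ and $f(x)=\omega(x)^{-i}\langle x\rangle^{-s}$ for $x\in\mathbb Z_p^\times$. Then $D\ne0$, $f$ is $\mu$-integrable on $\mathbb Z_p^\times$, and $$\zeta_{p,i}(s)=\frac{-1}{D}\int_{\mathbb Z_p^\times}f\,d\mu .$$ For every infinite $N$, the internal function $a+p^N\,{}^*\mathbb Z_p\mapsto{}^*f(a)$ ($0\le a<p^N$, $p\nmid a$) is a lifting of $f$ to $Y^\times$; and for every internal $F:Y\to{}^*\mathbb C_p$ lifting $f$ (that is, $\mathrm{st}(F(y))=f(\mathrm{st}_Y(y))$ for all $y\in Y^\times$) the following expressions are nearstandard before taking the standard part, and $$\zeta_{p,i}(s)=\frac{-1}{D}\,\mathrm{st}\Big(\int_{Y^\times}F\,d\nu\Big)=\frac{-1}{D}\,\mathrm{st}\Big(\sum_{m\le p^N,\ p\nmid m}\omega(m)^{-i}\langle m\rangle^{-s}\frac{(-1)^m}2\Big).$$ Moreover $$\zeta_{p,i}(s)=\frac1{2D}\sum_{n=1}^\infty\Big(\sum_{\substack{p^{n-1}\le m\le p^n\\ p\nmid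 m,\ m\text{ odd}}}\omega(m)^{-i}\langle m\rangle^{-s}-\sum_{\substack{p^{n-1}\le m\le p^n\\ p\nmid m,\ m\text{ even}}}\omega(m)^{-i}\langle m\rangle^{-s}\Big),$$ and the series over $n$ converges. (4) For every integer $k\neq1$ and $i=k\bmod (p-1)$ the following limit exists and $$\zeta_{p,i}(k)=\frac{-1}{1-2^{1-k}}\lim_{n\to\infty}\sum_{1\le m\le p^n,\ p\nmid m}\frac{(-1)^m}2\,m^{-k}.$$ -/

import Mathlib

open Filter Topology

noncomputable section

namespace PadicZeta

/-! ### Measures and integrals with values in a non-Archimedean field -/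

section Measure

variable {X K : Type*} [TopologicalSpace X] [NormedField K]

/-- `‖A‖_μ = sup { |μ(B)| : B ⊆ A, B clopen }`. -/
def setNorm (μ : Set X → K) (A : Set X) : ENNReal :=
  ⨆ (B : Set X) (_ : IsClopen B) (_ : B ⊆ A), ‖μ B‖ₑ

/-- The norm function `N_μ(x) = inf { ‖A‖_μ : x ∈ A, A clopen }`. -/
def normFun (μ : Set X → K) (x : X) : ENNReal :=
  ⨅ (A : Set X) (_ : IsClopen A) (_ : x ∈ A), setNorm μ A

/-- The seminorm `‖f‖_μ = sup_x |f(x)| N_μ(x)`. -/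
def funNorm (μ : Set X → K) (f : X → K) : ENNReal :=
  ⨆ x, ‖f x‖ₑ * normFun μ x

/-- A `K`-valued measure on the algebra of clopen subsets of `X` (only the values of `μ` on clopen
sets matter). -/
structure IsPadicMeasure (μ : Set X → K) : Prop where
  additive : ∀ A B : Set X, IsClopen A → IsClopen B → Disjoint A B → μ (A ∪ B) = μ A + μ B
  bounded : ∀ A : Set X, IsClopen A → setNorm μ A < ⊤
  continuous : ∀ R : Set (Set X), (∀ A ∈ R, IsClopen A) → (∀ A ∈ R, ∀ B ∈ R, A ∩ B ∈ R) →
    ⋂₀ R = ∅ → ∀ ε : ℝ, 0 < ε → ∃ A ∈ R, ‖μ A‖ < ε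

variable (X K) in
/-- A presentation `∑ j, c j • χ_{A j}` of a simple function, with clopen `A j`. -/
structure SimpleFn where
  size : ℕ
  sets : Fin size → Set X
  isClopen : ∀ j, IsClopen (sets j)
  coeff : Fin size → K

/-- The function `∑ j, c j • χ_{A j}`. -/
def SimpleFn.toFun (g : SimpleFn X K) (x : X) : K :=
  ∑ j, (g.sets j).indicator (fun _ => g.coeff j) x

/-- The integral `∑ j, c j μ(A j)` of a simple function. -/
def SimpleFn.integral (g : SimpleFn X K) (μ : Set X → K) : K :=
  ∑ j, g.coeff j * μ (g.sets j)

/-- `f` is `μ`-integrable with integral `v`: it is a limit in the seminorm `‖·‖_μ` of simple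
functions whose integrals tend to `v`. -/
def HasPadicIntegral (μ : Set X → K) (f : X → K) (v : K) : Prop :=
  ∃ g : ℕ → SimpleFn X K,
    Tendsto (fun k => funNorm μ (fun x => f x - (g k).toFun x)) atTop (𝓝 0) ∧
    Tendsto (fun k => (g k).integral μ) atTop (𝓝 v)

/-- `f · χ_E` is `μ`-integrable. -/
def PadicIntegrableOn (μ : Set X → K) (E : Set X) (f : X → K) : Prop :=
  ∃ v, HasPadicIntegral μ (E.indicator f) v

open Classical in
/-- The integral `∫_E f dμ`. -/
def padicIntegralOn (μ : Set X → K) (E : Set X) (f : X → K) : K :=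
  if h : PadicIntegrableOn μ E f then h.choose else 0

end Measure

/-! ### Nonstandard extensions as ultraproducts -/

section Nonstandard

universe u v w x

variable {I : Type u} {U : Ultrafilter I}

variable (U) in
/-- The internal set given by a family of sets `A i`, i.e. its ultraproduct. -/
abbrev UProd (A : I → Type v) : Type (max u v) := (U : Filter I).Product A

variable (U) in
/-- The nonstandard extension `*A` of a standard set `A`, i.e. its ultrapower. -/
abbrev Star (A : Type v) : Type (max u v) := UProd U (fun _ => A)

variable {A : I → Type v} {B : I → Type w} {C : I → Type x}

variable (U) in
/-- The internal object represented by a family. -/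
def UProd.mk (a : ∀ i, A i) : UProd U A :=
  Quotient.mk (Filter.productSetoid (U : Filter I) A) a

/-- An internal unary operation. -/
def UProd.map (f : ∀ i, A i → B i) : UProd U A → UProd U B :=
  Quotient.map' (fun a i => f i (a i)) (fun _ _ h => h.mono fun i hi => congrArg (f i) hi)

/-- An internal binary operation. -/
def UProd.map₂ (f : ∀ i, A i → B i → C i) : UProd U A → UProd U B → UProd U C :=
  Quotient.map₂ (fun a b i => f i (a i) (b i))
    (fun _ _ h _ _ h' => (h.and h').mono fun i hi => congrArg₂ (f i) hi.1 hi.2)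

/-- The internal predicate represented by the predicates `P i`. -/
def UProd.Holds (P : ∀ i, A i → Prop) (a : UProd U A) : Prop :=
  Quotient.liftOn' a (fun a => ∀ᶠ i in (U : Filter I), P i (a i))
    (fun _ _ h => propext (eventually_congr (h.mono fun i hi => by rw [hi])))

/-- The embedding of `A` into `*A`. -/
def Star.const {A : Type v} (a : A) : Star U A := UProd.mk U (fun _ => a)

/-- The value of the internal function `F` at the internal point `y`. -/
def UProd.app (F : UProd U (fun i => A i → B i)) (y : UProd U A) : UProd U B :=
  UProd.map₂ (fun _ f a => f a) F y

/-- Membership in a hyperfinite internal set. -/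
def UProd.Mem (y : UProd U A) (S : UProd U (fun i => Finset (A i))) : Prop :=
  UProd.Holds (fun _ (q : A _ × Finset (A _)) => q.1 ∈ q.2) (UProd.map₂ (fun _ a s => (a, s)) y S)

/-- The hyperfinite sum `∑_{y ∈ S} F(y)`. -/
def hyperSum {K : Type w} [AddCommMonoid K] (S : UProd U (fun i => Finset (A i)))
    (F : UProd U (fun i => A i → K)) : Star U K :=
  UProd.map₂ (fun _ s f => ∑ y ∈ s, f y) S F

/-- The integral `∫_S F dν = ∑_{y ∈ S} F(y) ν({y})` over an internal subset `S` of a hyperfinite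
space, the internal measure `ν` being given by its values on points. -/
def hyperIntegral {K : Type w} [Semiring K] (ν : UProd U (fun i => A i → K))
    (S : UProd U (fun i => Finset (A i))) (F : UProd U (fun i => A i → K)) : Star U K :=
  hyperSum S (UProd.map₂ (fun _ f g y => f y * g y) F ν)

/-- `N ∈ *ℕ` is infinite. -/
def IsInfiniteNat (N : Star U ℕ) : Prop := ∀ k : ℕ, UProd.Holds (fun _ m => k < m) N

/-- `y ∈ mon(x)`: `y` lies in `*V` for each open neighbourhood `V` of `x`. -/
def InMonad {X : Type v} [TopologicalSpace X] (y : Star U X) (x : X) : Prop :=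
  ∀ V : Set X, IsOpen V → x ∈ V → UProd.Holds (fun _ z => z ∈ V) y

/-- `y` is nearstandard. -/
def IsNearstandard {X : Type v} [TopologicalSpace X] (y : Star U X) : Prop := ∃ x, InMonad y x

/-- The standard part of `y` (meaningful if `y` is nearstandard and `X` is Hausdorff). -/
def st {X : Type v} [TopologicalSpace X] [Nonempty X] (y : Star U X) : X :=
  Classical.epsilon (InMonad y)

end Nonstandard

/-! ### The Teichmüller character and `p`-adic powers -/

section Padic

variable (p : ℕ) [Fact p.Prime]

/-- The inclusion `ℤ_p → ℂ_p`. -/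
def toCp (x : ℤ_[p]) : ℂ_[p] := algebraMap ℚ_[p] ℂ_[p] (x : ℚ_[p])

theorem exists_teichmuller (x : ℤ_[p]) (hx : IsUnit x) :
    ∃ w : ℂ_[p], w ^ (p - 1) = 1 ∧ ‖toCp p x - w‖ < 1 := by
  have hp : p.Prime := Fact.out
  have hx1 : ‖x‖ = 1 := PadicInt.isUnit_iff.mp hx
  let F : Polynomial ℤ_[p] := Polynomial.X ^ (p - 1) - 1
  have hF : ‖F.aeval x‖ < 1 := by
    have h0 : PadicInt.toZMod x ≠ 0 := by
      intro h
      have : x ∈ RingHom.ker (PadicInt.toZMod (p := p)) := h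
      rw [PadicInt.ker_toZMod] at this
      exact (IsLocalRing.mem_maximalIdeal _).mp this hx
    have : F.aeval x ∈ RingHom.ker (PadicInt.toZMod (p := p)) := by
      simp [F, RingHom.mem_ker, ZMod.pow_card_sub_one_eq_one h0]
    rw [PadicInt.ker_toZMod] at this
    exact PadicInt.mem_nonunits.mp ((IsLocalRing.mem_maximalIdeal _).mp this)
  have hF' : ‖F.derivative.aeval x‖ = 1 := by
    have hp1 : ‖((p - 1 : ℕ) : ℤ_[p])‖ = 1 := by
      rw [← PadicInt.isUnit_iff, PadicInt.isUnit_iff, PadicInt.norm_natCast_eq_one_iff]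
      exact (Nat.coprime_self_sub_right hp.one_lt.le).mpr (Nat.coprime_one_right p)
    simp [F, hx1, hp1, Polynomial.derivative_X_pow]
  obtain ⟨z, hz, hzx, -, -⟩ := hensels_lemma (F := F) (a := x) (by rw [hF']; simpa using hF)
  refine ⟨toCp p z, ?_, ?_⟩
  · have : z ^ (p - 1) = 1 := by simpa [F, sub_eq_zero] using hz
    have h2 : (z : ℚ_[p]) ^ (p - 1) = 1 := by
      exact_mod_cast congrArg (fun t : ℤ_[p] => (t : ℚ_[p])) this
    simp only [toCp]
    rw [← map_pow, h2, map_one]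
  · rw [hF'] at hzx
    simp only [toCp]
    rw [← map_sub, norm_algebraMap', ← PadicInt.coe_sub, PadicInt.padic_norm_e_of_padicInt,
      norm_sub_rev]
    exact hzx

open Classical in
/-- The Teichmüller character: for `x ∈ ℤ_p^×`, `ω(x)` is the `(p-1)`-st root of unity with
`ω(x) ≡ x mod p`; extended by `0`. -/
def teich (x : ℤ_[p]) : ℂ_[p] :=
  if hx : IsUnit x then (exists_teichmuller p x hx).choose else 0

/-- `⟨x⟩ = x / ω(x)` for `x ∈ ℤ_p^×`. -/
def angle (x : ℤ_[p]) : ℂ_[p] := toCp p x / teich p x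

/-- `log_p(z) = ∑_{n ≥ 1} (-1)^{n+1} (z - 1)^n / n`. -/
def padicLog (z : ℂ_[p]) : ℂ_[p] :=
  ∑' n : ℕ, (-1) ^ n * (z - 1) ^ (n + 1) / ((n : ℂ_[p]) + 1)

/-- `⟨x⟩^s = exp_p(s log_p ⟨x⟩)`. -/
def anglePow (x : ℤ_[p]) (s : ℂ_[p]) : ℂ_[p] :=
  NormedSpace.exp (s * padicLog p (angle p x))

/-- The function `x ↦ ω(x)^j ⟨x⟩^s` on `ℤ_p^×`. -/
def kernelFun (j : ZMod (p - 1)) (s : ℂ_[p]) (x : ℤ_[p]) : ℂ_[p] :=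
  teich p x ^ j.val * anglePow p x s

/-! ### The `p`-adic zeta functions -/

/-- The Volkenborn integral of `f` over `ℤ_p^×`. -/
def volkenbornUnits (f : ℤ_[p] → ℂ_[p]) : ℂ_[p] :=
  limUnder atTop (fun n : ℕ => (∑ m ∈ Finset.range (p ^ n) with ¬ p ∣ m, f m) / (p : ℂ_[p]) ^ n)

/-- `(-1)^{i-1} / (s-1) · ∫_{ℤ_p^×} ω(x)^{1-i} ⟨x⟩^{1-s} dx`, for `s ≠ 1`. -/
def zetaAux (i : ZMod (p - 1)) (s : ℂ_[p]) : ℂ_[p] :=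
  (-1) ^ (i - 1).val / (s - 1) * volkenbornUnits p (kernelFun p (1 - i) (1 - s))

open Classical in
/-- The `p`-adic zeta function `ζ_{p,i}(s) = L_p(s, ω^{1-i})`; the value at `s = 1` (for `i ≠ 1`) is
obtained by continuity. -/
def zeta (i : ZMod (p - 1)) (s : ℂ_[p]) : ℂ_[p] :=
  if s = 1 then limUnder (𝓝[≠] (1 : ℂ_[p])) (zetaAux p i) else zetaAux p i s

/-- The factor `1 - ω(2)^{1-i} ⟨2⟩^{1-s}`. -/
def eulerTwo (i : ZMod (p - 1)) (s : ℂ_[p]) : ℂ_[p] := 1 - kernelFun p (1 - i) (1 - s) 2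

/-! ### The regularized Bernoulli measure -/

/-- The ball `a + p^n ℤ_p`. -/
def ball (a : ℤ_[p]) (n : ℕ) : Set ℤ_[p] := {x | (p : ℤ_[p]) ^ n ∣ x - a}

open Classical in
/-- The Bernoulli distribution: the additive function of clopen sets with
`μ₁(a + p^n ℤ_p) = a / p^n - 1/2` for `0 ≤ a < p^n`. For clopen `V` the sequence below is eventually
constant: `V` is the disjoint union of the balls `a + p^n ℤ_p` with `0 ≤ a < p^n`, `a ∈ V`, as soon
as `n` is large. -/
def bernoulliDist (V : Set ℤ_[p]) : ℂ_[p] :=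
  limUnder atTop (fun n : ℕ =>
    ∑ a ∈ Finset.range (p ^ n) with ((a : ℕ) : ℤ_[p]) ∈ V, ((a : ℂ_[p]) / (p : ℂ_[p]) ^ n - 1 / 2))

/-- `μ(V) = μ₁(V) - 2 μ₁(½ V)`. -/
def regBernoulli (V : Set ℤ_[p]) : ℂ_[p] :=
  bernoulliDist p V - 2 * bernoulliDist p {x | 2 * x ∈ V}

/-! ### The hyperfinite space `Y = *ℤ_p / p^N *ℤ_p` -/

variable {I : Type*} (U : Ultrafilter I) (n : I → ℕ)

/-- `Y = *ℤ_p / p^N *ℤ_p`, where `N ∈ *ℕ` is the class of the family `n`. -/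
abbrev HyperY := UProd U (fun i => ZMod (p ^ n i))

/-- The representative `0 ≤ a < p^N` of a point of `Y`, as an element of `*ℤ_p`. -/
def hyperRep (y : HyperY p U n) : Star U ℤ_[p] := UProd.map (fun _ z => ((z.val : ℕ) : ℤ_[p])) y

/-- The standard-part map `st_Y : Y → ℤ_p`. -/
def stY (y : HyperY p U n) : ℤ_[p] := st (hyperRep p U n y)

open Classical in
/-- The internal set `Y^× = (*ℤ_p / p^N *ℤ_p)^×`. -/
def hyperUnits : UProd U (fun i => Finset (ZMod (p ^ n i))) :=
  UProd.mk U (fun _ => Finset.univ.filter IsUnit)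

/-- The internal measure with `ν({a + p^N *ℤ_p}) = (-1)^a / 2` for `0 ≤ a < p^N`. -/
def hyperNu : UProd U (fun i => ZMod (p ^ n i) → ℂ_[p]) :=
  UProd.mk U (fun _ y => (-1) ^ y.val / 2)

/-- The internal subset `S` of `Y` is the inverse image of `V ⊆ ℤ_p` under `st_Y`. -/
def IsStPreimage (S : UProd U (fun i => Finset (ZMod (p ^ n i)))) (V : Set ℤ_[p]) : Prop :=
  ∀ y : HyperY p U n, UProd.Mem y S ↔ stY p U n y ∈ V

/-- `(ℤ_p, clopen sets, μ)` is the push-down of `(Y, internal subsets, ν)` via `st_Y`: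
`V ⊆ ℤ_p` is clopen iff `st_Y⁻¹(V)` is internal, and then `ν(st_Y⁻¹(V)) = μ(V)`. -/
def IsPushDown (μ : Set ℤ_[p] → ℂ_[p]) (ν : UProd U (fun i => ZMod (p ^ n i) → ℂ_[p])) : Prop :=
  (∀ V : Set ℤ_[p], IsClopen V ↔ ∃ S, IsStPreimage p U n S V) ∧
  ∀ V : Set ℤ_[p], IsClopen V → ∀ S, IsStPreimage p U n S V → hyperSum S ν = Star.const (μ V)

/-- The internal function `F` on `Y` is a lifting of `f` on `Y^×`: for all `y ∈ Y^×`, `F(y)` is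
nearstandard and `st(F(y)) = f(st_Y(y))`. -/
def IsLiftOnUnits (f : ℤ_[p] → ℂ_[p]) (F : UProd U (fun i => ZMod (p ^ n i) → ℂ_[p])) : Prop :=
  ∀ y : HyperY p U n, UProd.Mem y (hyperUnits p U n) → InMonad (UProd.app F y) (f (stY p U n y))

/-- The internal function `a + p^N *ℤ_p ↦ *f(a)` (`0 ≤ a < p^N`) on `Y`. -/
def canonicalLift (f : ℤ_[p] → ℂ_[p]) : UProd U (fun i => ZMod (p ^ n i) → ℂ_[p]) :=
  UProd.mk U (fun _ y => f ((y.val : ℕ) : ℤ_[p]))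

/-- The hyperfinite set `{m ∈ *ℕ : m ≤ p^N, p ∤ m}`. -/
def hyperRange : UProd U (fun _ => Finset ℕ) :=
  UProd.mk U (fun i => (Finset.range (p ^ n i + 1)).filter (fun m => ¬ p ∣ m))

end Padic

end PadicZeta

end

noncomputable section

namespace PadicZeta

/-! ### Exponential and logarithm on `ℂ_p` -/

section ExpLog

variable (p : ℕ) [Fact p.Prime]

/-! Everything is reduced to the alternating sums `altSum F n`, that is `∑ F(a) (-1)^a / 2` over `0
≤ a < p^n`. Since `p` is odd, the signs `(-1)^(p^n c + b)`, `0 ≤ c < p`, add up to `(-1)^b`. By the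
ultrametric inequality, passing from `n` to `n + 1` thus changes the sum by at most the oscillation
of `F` on balls of radius `p^(-n)` (`norm_altSum_succ_sub_le`), so the sums converge for uniformly
continuous `F`.

The link with zeta is the doubling trick. Put `g = ω^(1-i)⟨·⟩^(1-s)` and `f = ω^(-i)⟨·⟩^(-s)`, both
extended by `0` to non-units. As `g` is multiplicative, `g(2) ∑ g(a) = ∑ g(2a)`; reducing `2a`
modulo the odd number `q = p^n` replaces each odd `b` by `b + q`. Hence `D ∑ g(a) / q` equals minus
the sum over odd `b` of `(g(b+q) - g(b)) / q`, a difference quotient close to `(1-s) f(b)`. The sum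
of `f` over odd `b` is half its full sum, which tends to `0`, minus its alternating sum. So `D`
times the Volkenborn integral is `(1-s)` times the limit of `altSum f`
(`volkenbornUnits_kernelFun`). The sign `(-1)^(i-1)` is harmless: when it is `-1`, `f` is even and
the limit vanishes. The point `s = 1` follows by continuity (`zeta_eq`).

The same doubling gives `μ(V) = altSum χ_V n` for large `n` (`IsUnionOfBalls.regBernoulli_eq`).
Balls have measure of norm `1`, so the seminorm of `μ` is the sup norm and integrals are limits of
alternating sums. The series telescopes these sums.

On the nonstandard side, being infinite means `n → ∞` along the ultrafilter, and lying in a monad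
means converging along it, so hyperfinite sums inherit the limits of `altSum`. Two saturation
arguments remain, both done by choosing a point for each index: sets with internal preimage are
open, and any lifting is uniformly close to the canonical one. -/

/-- The radius of convergence `p^{-1/(p-1)}` of the `p`-adic exponential series. -/
def expRadius : ℝ := (p : ℝ) ^ (-(1 / ((p : ℝ) - 1)))

variable {p}

lemma one_lt_cast_prime : (1 : ℝ) < p := by exact_mod_cast (Fact.out : p.Prime).one_lt

lemma expRadius_pos : 0 < expRadius p :=
  Real.rpow_pos_of_pos (zero_lt_one.trans one_lt_cast_prime) _

lemma expRadius_lt_one : expRadius p < 1 := by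
  have h := one_lt_cast_prime (p := p)
  refine Real.rpow_lt_one_of_one_lt_of_neg h ?_
  have : 0 < 1 / ((p : ℝ) - 1) := by apply one_div_pos.mpr; linarith
  linarith

lemma norm_natCast_padicComplex (n : ℕ) : ‖(n : ℂ_[p])‖ = ‖(n : ℚ_[p])‖ := by
  rw [← map_natCast (algebraMap ℚ_[p] ℂ_[p]), norm_algebraMap']

lemma norm_natCast_le_one (n : ℕ) : ‖(n : ℂ_[p])‖ ≤ 1 := by
  rw [norm_natCast_padicComplex]
  exact_mod_cast Padic.norm_int_le_one (p := p) n

lemma norm_prime_pow (n : ℕ) : ‖(p : ℂ_[p]) ^ n‖ = ((p : ℝ)⁻¹) ^ n := by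
  rw [norm_pow, norm_natCast_padicComplex, Padic.norm_p]

lemma prime_pow_ne_zero (n : ℕ) : (p : ℂ_[p]) ^ n ≠ 0 :=
  pow_ne_zero _ (Nat.cast_ne_zero.mpr (Fact.out : p.Prime).ne_zero)

lemma tendsto_prime_pow : Tendsto (fun n : ℕ => (p : ℂ_[p]) ^ n) atTop (𝓝 0) := by
  rw [tendsto_zero_iff_norm_tendsto_zero]
  simp only [norm_prime_pow]
  exact tendsto_pow_atTop_nhds_zero_of_lt_one (by positivity)
    (inv_lt_one_of_one_lt₀ one_lt_cast_prime)

/-- Legendre's formula gives `(p - 1) v((n+1)!) < n + 1`. The shifted index makes the bound sharp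
enough that the coefficient of `z^(n+1)` costs only `r^(-n)`, leaving a factor `‖z‖` in front of a
geometric series. -/
lemma norm_inv_factorial_le (n : ℕ) :
    ‖(((n + 1).factorial : ℕ) : ℂ_[p])⁻¹‖ ≤ ((expRadius p)⁻¹) ^ n := by
  have h1 := one_lt_cast_prime (p := p)
  have h0 : (0 : ℝ) < p := zero_lt_one.trans h1
  have hv : (p - 1) * padicValNat p (n + 1).factorial ≤ n := Nat.lt_succ_iff.mp
    (sub_one_mul_padicValNat_factorial_lt_of_ne_zero p n.succ_ne_zero)
  have hv' : ((p : ℝ) - 1) * padicValNat p (n + 1).factorial ≤ n := by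
    have := (Nat.cast_le (α := ℝ)).mpr hv
    rwa [Nat.cast_mul, Nat.cast_sub (Fact.out : p.Prime).one_lt.le, Nat.cast_one] at this
  have hne : (((n + 1).factorial : ℕ) : ℚ_[p]) ≠ 0 :=
    Nat.cast_ne_zero.mpr (Nat.factorial_ne_zero _)
  rw [norm_inv, norm_natCast_padicComplex, Padic.norm_eq_zpow_neg_valuation hne,
    Padic.valuation_natCast, ← zpow_neg, neg_neg, zpow_natCast, expRadius, ← Real.rpow_neg h0.le,
    neg_neg, ← Real.rpow_natCast, ← Real.rpow_natCast, ← Real.rpow_mul h0.le]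
  refine Real.rpow_le_rpow_of_exponent_le h1.le ?_
  rw [div_mul_eq_mul_div, one_mul, le_div_iff₀ (by linarith), mul_comm]
  exact hv'

/-- Since `1/(n+1) = n!/(n+1)!`, the logarithm obeys the coefficient bound of the exponential. This
is crude but lets both series be treated together on the disc of radius `expRadius p`. -/
lemma norm_inv_natCast_le (n : ℕ) : ‖((n : ℂ_[p]) + 1)⁻¹‖ ≤ ((expRadius p)⁻¹) ^ n := by
  refine le_trans ?_ (norm_inv_factorial_le n)
  have h : (((n + 1).factorial : ℕ) : ℂ_[p])⁻¹ = ((n : ℂ_[p]) + 1)⁻¹ * ((n.factorial : ℕ) : ℂ_[p])⁻¹ := by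
    rw [Nat.factorial_succ, Nat.cast_mul, mul_inv, Nat.cast_add, Nat.cast_one]
  rw [h, norm_mul]
  refine le_mul_of_one_le_right (norm_nonneg _) ?_
  rw [norm_inv]
  exact (one_le_inv₀ (norm_pos_iff.mpr (Nat.cast_ne_zero.mpr (Nat.factorial_ne_zero _)))).mpr
    (norm_natCast_le_one _)

lemma norm_coeff_mul_pow_le {c : ℕ → ℂ_[p]} {r : ℝ} (hc : ∀ n, ‖c n‖ ≤ r⁻¹ ^ n)
    (z : ℂ_[p]) (n : ℕ) : ‖c n * z ^ (n + 1)‖ ≤ ‖z‖ * (‖z‖ / r) ^ n := by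
  rw [norm_mul, norm_pow, pow_succ, div_eq_mul_inv, mul_pow]
  calc ‖c n‖ * (‖z‖ ^ n * ‖z‖) ≤ r⁻¹ ^ n * (‖z‖ ^ n * ‖z‖) := by gcongr; exact hc n
    _ = _ := by ring

lemma summable_norm_mul_div_pow {r : ℝ} (hr : 0 < r) {z : ℂ_[p]} (hz : ‖z‖ < r) :
    Summable (fun n : ℕ => ‖z‖ * (‖z‖ / r) ^ n) :=
  (summable_geometric_of_lt_one (by positivity) ((div_lt_one hr).mpr hz)).mul_left _

lemma summable_coeff_mul_pow {c : ℕ → ℂ_[p]} {r : ℝ} (hr : 0 < r) (hc : ∀ n, ‖c n‖ ≤ r⁻¹ ^ n)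
    {z : ℂ_[p]} (hz : ‖z‖ < r) : Summable (fun n => c n * z ^ (n + 1)) :=
  Summable.of_norm_bounded (summable_norm_mul_div_pow hr hz) (norm_coeff_mul_pow_le hc z)

lemma norm_tsum_le_of_forall_norm_le {f : ℕ → ℂ_[p]} (hf : Summable f) {C : ℝ} (hC : 0 ≤ C)
    (h : ∀ n, ‖f n‖ ≤ C) : ‖∑' n, f n‖ ≤ C :=
  le_of_tendsto hf.hasSum.tendsto_sum_nat.norm (Eventually.of_forall fun _ =>
    IsUltrametricDist.norm_sum_le_of_forall_le_of_nonneg hC fun _ _ => h _)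

/-- Every term after the linear one is at most `‖z‖ (‖z‖ / r)`, and the ultrametric inequality
passes this bound to the tail. For `exp` and `log` it yields both the isometry property and the
first-order expansion. -/
lemma norm_tsum_coeff_sub_le {c : ℕ → ℂ_[p]} {r : ℝ} (hr : 0 < r) (h0 : c 0 = 1)
    (hc : ∀ n, ‖c n‖ ≤ r⁻¹ ^ n) {z : ℂ_[p]} (hz : ‖z‖ < r) :
    ‖∑' n, c n * z ^ (n + 1) - z‖ ≤ ‖z‖ * (‖z‖ / r) := by
  have hs := summable_coeff_mul_pow hr hc hz
  rw [hs.tsum_eq_zero_add, h0]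
  simp only [zero_add, pow_one, one_mul, add_sub_cancel_left]
  refine norm_tsum_le_of_forall_norm_le ((summable_nat_add_iff 1).mpr hs) (by positivity) fun n => ?_
  refine (norm_coeff_mul_pow_le hc z (n + 1)).trans ?_
  gcongr
  rw [pow_succ]
  exact mul_le_of_le_one_left (by positivity)
    (pow_le_one₀ (by positivity) ((div_lt_one hr).mpr hz).le)

lemma exp_eq_one_add_tsum {z : ℂ_[p]} (hz : ‖z‖ < expRadius p) :
    NormedSpace.exp z = 1 + ∑' n : ℕ, (((n + 1).factorial : ℕ) : ℂ_[p])⁻¹ * z ^ (n + 1) := by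
  have hs := summable_coeff_mul_pow expRadius_pos (norm_inv_factorial_le (p := p)) hz
  have hs' : Summable (fun n : ℕ => ((n.factorial : ℕ) : ℂ_[p])⁻¹ * z ^ n) :=
    (summable_nat_add_iff 1).mp hs
  rw [NormedSpace.exp_eq_tsum ℂ_[p]]
  simp only [smul_eq_mul]
  rw [hs'.tsum_eq_zero_add]
  simp

lemma norm_exp_sub_one_sub_le {z : ℂ_[p]} (hz : ‖z‖ < expRadius p) :
    ‖NormedSpace.exp z - 1 - z‖ ≤ ‖z‖ * (‖z‖ / expRadius p) := by
  rw [exp_eq_one_add_tsum hz, add_sub_cancel_left]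
  exact norm_tsum_coeff_sub_le expRadius_pos (by simp) norm_inv_factorial_le hz

lemma norm_eq_of_norm_sub_le {r : ℝ} (hr : 0 < r) {z w : ℂ_[p]} (hz : ‖z‖ < r)
    (h : ‖w - z‖ ≤ ‖z‖ * (‖z‖ / r)) : ‖w‖ = ‖z‖ := by
  rcases eq_or_ne z 0 with rfl | h0
  · simpa [sub_eq_zero] using h
  · have h1 : ‖w - z‖ < ‖z‖ := h.trans_lt
      (mul_lt_of_lt_one_right (norm_pos_iff.mpr h0) ((div_lt_one hr).mpr hz))
    have := IsUltrametricDist.norm_add_eq_max_of_norm_ne_norm h1.ne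
    rw [sub_add_cancel] at this
    rw [this, max_eq_right h1.le]

lemma norm_exp_sub_one {z : ℂ_[p]} (hz : ‖z‖ < expRadius p) : ‖NormedSpace.exp z - 1‖ = ‖z‖ :=
  norm_eq_of_norm_sub_le expRadius_pos hz (norm_exp_sub_one_sub_le hz)

lemma expRadius_le_radius :
    ENNReal.ofReal (expRadius p) ≤ (NormedSpace.expSeries ℂ_[p] ℂ_[p]).radius := by
  refine FormalMultilinearSeries.le_radius_of_bound _ 1 fun n => ?_
  rw [Real.coe_toNNReal _ expRadius_pos.le]
  have hn : ‖NormedSpace.expSeries ℂ_[p] ℂ_[p] n‖ ≤ ‖((n.factorial : ℕ) : ℂ_[p])⁻¹‖ := by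
    simp only [NormedSpace.expSeries]
    rw [norm_smul, ContinuousMultilinearMap.norm_mkPiAlgebraFin, mul_one]
  cases n with
  | zero => simpa using hn
  | succ n =>
    have h1 := hn.trans (norm_inv_factorial_le n)
    have h2 := expRadius_pos (p := p)
    calc _ ≤ (expRadius p)⁻¹ ^ n * expRadius p ^ (n + 1) := by gcongr
      _ = expRadius p := by rw [pow_succ, ← mul_assoc, ← mul_pow, inv_mul_cancel₀ h2.ne']; simp
      _ ≤ 1 := expRadius_lt_one.le

lemma exp_add_of_norm_lt {x y : ℂ_[p]} (hx : ‖x‖ < expRadius p) (hy : ‖y‖ < expRadius p) :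
    NormedSpace.exp (x + y) = NormedSpace.exp x * NormedSpace.exp y := by
  have key : ∀ z : ℂ_[p], ‖z‖ < expRadius p →
      z ∈ Metric.eball (0 : ℂ_[p]) (NormedSpace.expSeries ℂ_[p] ℂ_[p]).radius := fun z hz => by
    refine Metric.eball_subset_eball expRadius_le_radius ?_
    rw [Metric.eball_ofReal]
    simpa using hz
  exact NormedSpace.exp_add_of_mem_ball (𝕂 := ℂ_[p]) (key x hx) (key y hy)

lemma exp_natCast_mul {z : ℂ_[p]} (hz : ‖z‖ < expRadius p) (n : ℕ) :
    NormedSpace.exp (n * z) = NormedSpace.exp z ^ n := by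
  induction n with
  | zero => simp
  | succ n ih =>
    have : ‖(n : ℂ_[p]) * z‖ < expRadius p := by
      rw [norm_mul]
      exact (mul_le_of_le_one_left (norm_nonneg _) (norm_natCast_le_one n)).trans_lt hz
    rw [Nat.cast_succ, add_mul, one_mul, exp_add_of_norm_lt this hz, ih, pow_succ]

lemma log_coeff_le (n : ℕ) : ‖(-1) ^ n * ((n : ℂ_[p]) + 1)⁻¹‖ ≤ (expRadius p)⁻¹ ^ n := by
  rw [norm_mul, norm_pow, norm_neg, norm_one, one_pow, one_mul]
  exact norm_inv_natCast_le n

lemma padicLog_eq (z : ℂ_[p]) :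
    padicLog p z = ∑' n : ℕ, ((-1) ^ n * ((n : ℂ_[p]) + 1)⁻¹) * (z - 1) ^ (n + 1) := by
  rw [padicLog]
  congr 1; funext n
  rw [div_eq_mul_inv]; ring

lemma norm_padicLog_sub_le {u : ℂ_[p]} (hu : ‖u - 1‖ < expRadius p) :
    ‖padicLog p u - (u - 1)‖ ≤ ‖u - 1‖ * (‖u - 1‖ / expRadius p) := by
  rw [padicLog_eq]
  exact norm_tsum_coeff_sub_le expRadius_pos (by simp) log_coeff_le hu

lemma norm_padicLog {u : ℂ_[p]} (hu : ‖u - 1‖ < expRadius p) : ‖padicLog p u‖ = ‖u - 1‖ :=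
  norm_eq_of_norm_sub_le expRadius_pos hu (norm_padicLog_sub_le hu)

/-! ### The logarithm as a limit of `p^n`-th powers. -/

lemma choose_prime_pow_succ (n k : ℕ) :
    ((p ^ n).choose (k + 1) : ℂ_[p]) =
      (p : ℂ_[p]) ^ n * (((p ^ n - 1).choose k : ℂ_[p]) * ((k : ℂ_[p]) + 1)⁻¹) := by
  obtain ⟨q, hq⟩ : ∃ q, p ^ n = q + 1 :=
    Nat.exists_eq_succ_of_ne_zero (pow_ne_zero _ (Fact.out : p.Prime).ne_zero)
  have h := Nat.add_one_mul_choose_eq q k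
  have h' : ((q : ℂ_[p]) + 1) * (q.choose k : ℂ_[p]) = ((q + 1).choose (k + 1) : ℂ_[p]) * (k + 1) := by
    exact_mod_cast h
  have hk : (k : ℂ_[p]) + 1 ≠ 0 := by exact_mod_cast k.succ_ne_zero
  have hq' : (p : ℂ_[p]) ^ n = q + 1 := by exact_mod_cast congrArg (Nat.cast (R := ℂ_[p])) hq
  rw [hq', hq, Nat.add_sub_cancel, ← mul_assoc, h', mul_assoc, mul_inv_cancel₀ hk, mul_one]

/-- Pascal's rule: consecutive binomials of `p^n - 1` add up to one of `p^n`, which tends to `0`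
`p`-adically, so each step in `k` flips the sign of the limit. -/
lemma tendsto_choose_prime_pow_sub_one (k : ℕ) :
    Tendsto (fun n : ℕ => ((p ^ n - 1).choose k : ℂ_[p])) atTop (𝓝 ((-1) ^ k)) := by
  induction k with
  | zero => simp
  | succ k ih =>
    have h1 : Tendsto (fun n : ℕ => ((p ^ n).choose (k + 1) : ℂ_[p])) atTop (𝓝 0) := by
      simp only [choose_prime_pow_succ]
      simpa using tendsto_prime_pow.mul (ih.mul_const ((k : ℂ_[p]) + 1)⁻¹)
    have h2 := h1.sub ih
    rw [zero_sub, ← mul_neg_one, ← pow_succ] at h2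
    refine h2.congr fun n => ?_
    obtain ⟨q, hq⟩ : ∃ q, p ^ n = q + 1 :=
      Nat.exists_eq_succ_of_ne_zero (pow_ne_zero _ (Fact.out : p.Prime).ne_zero)
    rw [hq, Nat.add_sub_cancel, Nat.choose_succ_succ, Nat.cast_add, add_sub_cancel_left]

lemma pow_prime_pow_sub_one_div (t : ℂ_[p]) (n : ℕ) :
    ((1 + t) ^ p ^ n - 1) / (p : ℂ_[p]) ^ n =
      ∑' k : ℕ, (((p ^ n - 1).choose k : ℂ_[p]) * ((k : ℂ_[p]) + 1)⁻¹) * t ^ (k + 1) := by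
  rw [tsum_eq_sum (s := Finset.range (p ^ n)) fun k hk => ?_]
  · rw [div_eq_iff (prime_pow_ne_zero n), Finset.sum_mul, add_comm, add_pow, Finset.sum_range_succ']
    simp only [one_pow, mul_one, pow_zero, Nat.choose_zero_right, Nat.cast_one,
      add_sub_cancel_right]
    refine Finset.sum_congr rfl fun k _ => ?_
    rw [choose_prime_pow_succ]; ring
  · rw [Nat.choose_eq_zero_of_lt, Nat.cast_zero, zero_mul, zero_mul]
    have := pow_pos (Fact.out : p.Prime).pos n
    rw [Finset.mem_range] at hk
    omega

/-- `log_p u = lim (u^{p^n} - 1) / p^n`. -/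
lemma tendsto_pow_prime_pow_sub_one_div {u : ℂ_[p]} (hu : ‖u - 1‖ < expRadius p) :
    Tendsto (fun n : ℕ => (u ^ p ^ n - 1) / (p : ℂ_[p]) ^ n) atTop (𝓝 (padicLog p u)) := by
  obtain ⟨t, rfl⟩ : ∃ t, u = 1 + t := ⟨u - 1, by ring⟩
  rw [padicLog_eq]
  simp only [add_sub_cancel_left] at hu ⊢
  simp only [pow_prime_pow_sub_one_div]
  refine tendsto_tsum_of_dominated_convergence (β := ℕ)
    (bound := fun k => ‖t‖ * (‖t‖ / expRadius p) ^ k)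
    (summable_norm_mul_div_pow expRadius_pos hu) ?_ ?_
  · intro k
    exact ((tendsto_choose_prime_pow_sub_one k).mul_const _).mul_const _
  · refine Eventually.of_forall fun n k => norm_coeff_mul_pow_le
      (c := fun k => ((p ^ n - 1).choose k : ℂ_[p]) * ((k : ℂ_[p]) + 1)⁻¹) (fun k => ?_) t k
    rw [norm_mul]
    exact (mul_le_of_le_one_left (norm_nonneg _) (norm_natCast_le_one _)).trans
      (norm_inv_natCast_le k)

lemma norm_mul_sub_one_lt {u v : ℂ_[p]} (hu : ‖u - 1‖ < expRadius p)
    (hv : ‖v - 1‖ < expRadius p) : ‖u * v - 1‖ < expRadius p := by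
  have h : u * v - 1 = (u - 1) * (v - 1) + ((u - 1) + (v - 1)) := by ring
  rw [h]
  refine (IsUltrametricDist.norm_add_le_max _ _).trans_lt (max_lt ?_
    ((IsUltrametricDist.norm_add_le_max _ _).trans_lt (max_lt hu hv)))
  rw [norm_mul]
  exact (mul_le_of_le_one_right (norm_nonneg _) (hv.trans expRadius_lt_one).le).trans_lt hu

/-- In `(uv)^q - 1 = (u^q - 1)(v^q - 1) + (u^q - 1) + (v^q - 1)` with `q = p^n`, division by `q`
leaves the product term a spare factor `q`, which kills it in the limit. -/
lemma padicLog_mul {u v : ℂ_[p]} (hu : ‖u - 1‖ < expRadius p) (hv : ‖v - 1‖ < expRadius p) :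
    padicLog p (u * v) = padicLog p u + padicLog p v := by
  have h1 := tendsto_pow_prime_pow_sub_one_div hu
  have h2 := tendsto_pow_prime_pow_sub_one_div hv
  have h3 := (tendsto_prime_pow.mul (h1.mul h2)).add (h1.add h2)
  rw [zero_mul, zero_add] at h3
  refine tendsto_nhds_unique (tendsto_pow_prime_pow_sub_one_div (norm_mul_sub_one_lt hu hv))
    (h3.congr fun n => ?_)
  have := prime_pow_ne_zero (p := p) n
  rw [mul_pow]
  field_simp
  ring

/-- `exp(z)^(p^n) = exp(p^n z) = 1 + p^n z + O(p^(2n))`, so the quotients defining the logarithm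
differ from `z` by `O(p^n)`. -/
lemma padicLog_exp {z : ℂ_[p]} (hz : ‖z‖ < expRadius p) : padicLog p (NormedSpace.exp z) = z := by
  have h0 := tendsto_pow_prime_pow_sub_one_div (u := NormedSpace.exp z)
    (by rwa [norm_exp_sub_one hz])
  refine tendsto_nhds_unique h0 ?_
  rw [tendsto_iff_norm_sub_tendsto_zero]
  have h1 : Tendsto (fun n : ℕ => ‖(p : ℂ_[p]) ^ n‖ * (‖z‖ * (‖z‖ / expRadius p))) atTop (𝓝 0) := by
    simpa using (tendsto_prime_pow (p := p)).norm.mul_const (‖z‖ * (‖z‖ / expRadius p))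
  refine squeeze_zero (fun _ => norm_nonneg _) (fun n => ?_) h1
  have hn := prime_pow_ne_zero (p := p) n
  have hn' : 0 < ‖(p : ℂ_[p]) ^ n‖ := norm_pos_iff.mpr hn
  have hle : ‖(p : ℂ_[p]) ^ n * z‖ < expRadius p := by
    rw [norm_mul]
    refine (mul_le_of_le_one_left (norm_nonneg _) ?_).trans_lt hz
    exact_mod_cast norm_natCast_le_one (p := p) (p ^ n)
  have hexp : NormedSpace.exp z ^ p ^ n = NormedSpace.exp ((p : ℂ_[p]) ^ n * z) := by
    rw [← exp_natCast_mul hz, Nat.cast_pow]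
  have : (NormedSpace.exp z ^ p ^ n - 1) / (p : ℂ_[p]) ^ n - z =
      (NormedSpace.exp ((p : ℂ_[p]) ^ n * z) - 1 - (p : ℂ_[p]) ^ n * z) / (p : ℂ_[p]) ^ n := by
    rw [hexp]; field_simp
  rw [this, norm_div, div_le_iff₀ hn']
  refine (norm_exp_sub_one_sub_le hle).trans (le_of_eq ?_)
  rw [norm_mul]; ring

lemma norm_eq_one_of_norm_sub_one_lt {u : ℂ_[p]} (h : ‖u - 1‖ < 1) : ‖u‖ = 1 := by
  have := IsUltrametricDist.norm_add_eq_max_of_norm_ne_norm (x := u - 1) (y := 1)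
    (by rw [norm_one]; exact h.ne)
  rw [sub_add_cancel, norm_one] at this
  rw [this, max_eq_right h.le]

/-- The quotient `u / v` has logarithm `0`, and the logarithm preserves the distance to `1`. -/
lemma eq_of_padicLog_eq {u v : ℂ_[p]} (hu : ‖u - 1‖ < expRadius p) (hv : ‖v - 1‖ < expRadius p)
    (h : padicLog p u = padicLog p v) : u = v := by
  have hv1 := norm_eq_one_of_norm_sub_one_lt (hv.trans expRadius_lt_one)
  have hv0 : v ≠ 0 := fun h => by simp [h] at hv1
  have hw : ‖u / v - 1‖ < expRadius p := by
    have : u / v - 1 = ((u - 1) - (v - 1)) / v := by field_simp; ring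
    rw [this, norm_div, hv1, div_one]
    rw [sub_eq_add_neg]
    exact (IsUltrametricDist.norm_add_le_max _ _).trans_lt (max_lt hu (by rwa [norm_neg]))
  have h1 : padicLog p (u / v) = 0 := by
    have := padicLog_mul hw hv
    rw [div_mul_cancel₀ _ hv0, h] at this
    simpa using this
  have h2 := norm_padicLog hw
  rw [h1, norm_zero] at h2
  exact (div_eq_one_iff_eq hv0).mp (sub_eq_zero.mp (norm_eq_zero.mp h2.symm))

lemma exp_padicLog {u : ℂ_[p]} (hu : ‖u - 1‖ < expRadius p) :
    NormedSpace.exp (padicLog p u) = u := by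
  have h : ‖padicLog p u‖ < expRadius p := by rwa [norm_padicLog hu]
  exact eq_of_padicLog_eq (by rwa [norm_exp_sub_one h]) hu (padicLog_exp h)

end ExpLog

/-! ### The Teichmüller character and the functions `ω(x)^j ⟨x⟩^s` -/

section Kernel

variable {p : ℕ} [Fact p.Prime]

variable (p) in
/-- The inclusion `ℤ_p → ℂ_p` as a ring homomorphism. -/
def toCpHom : ℤ_[p] →+* ℂ_[p] := (algebraMap ℚ_[p] ℂ_[p]).comp PadicInt.Coe.ringHom

lemma toCp_eq_hom (x : ℤ_[p]) : toCp p x = toCpHom p x := rfl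

lemma toCp_natCast (n : ℕ) : toCp p n = n := map_natCast (toCpHom p) n

lemma toCp_mul (x y : ℤ_[p]) : toCp p (x * y) = toCp p x * toCp p y := map_mul (toCpHom p) x y

lemma toCp_sub (x y : ℤ_[p]) : toCp p (x - y) = toCp p x - toCp p y := map_sub (toCpHom p) x y

lemma toCp_one : toCp p 1 = 1 := map_one (toCpHom p)

lemma toCp_pow (x : ℤ_[p]) (n : ℕ) : toCp p (x ^ n) = toCp p x ^ n := map_pow (toCpHom p) x n

lemma norm_toCp (x : ℤ_[p]) : ‖toCp p x‖ = ‖x‖ := by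
  rw [toCp, norm_algebraMap', PadicInt.padic_norm_e_of_padicInt]

/-! ### Units close to `1` and roots of unity of order dividing `p - 1`. -/

lemma norm_pow_sub_one_le {u : ℂ_[p]} (hu : ‖u‖ = 1) (n : ℕ) : ‖u ^ n - 1‖ ≤ ‖u - 1‖ := by
  rw [← geom_sum_mul, norm_mul]
  refine mul_le_of_le_one_left (norm_nonneg _)
    (IsUltrametricDist.norm_sum_le_of_forall_le_of_nonneg zero_le_one fun i _ => ?_)
  rw [norm_pow, hu, one_pow]

/-- The cofactor `1 + u + ... + u^(p-2)` is congruent to `p - 1`, hence to `-1`, modulo elements of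
norm `< 1`; so it has norm `1`. -/
lemma norm_pow_prime_sub_one {u : ℂ_[p]} (hu : ‖u - 1‖ < 1) : ‖u ^ (p - 1) - 1‖ = ‖u - 1‖ := by
  have hu1 := norm_eq_one_of_norm_sub_one_lt hu
  have hp1 : (1 : ℝ) < p := one_lt_cast_prime
  have key : ‖-(∑ i ∈ Finset.range (p - 1), u ^ i) - 1‖ < 1 := by
    have : -(∑ i ∈ Finset.range (p - 1), u ^ i) - 1 =
        -((p : ℂ_[p]) + ∑ i ∈ Finset.range (p - 1), (u ^ i - 1)) := by
      rw [Finset.sum_sub_distrib]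
      simp only [Finset.sum_const, Finset.card_range, nsmul_eq_mul, mul_one]
      rw [Nat.cast_sub (Fact.out : p.Prime).one_lt.le]
      push_cast; ring
    rw [this, norm_neg]
    refine (IsUltrametricDist.norm_add_le_max _ _).trans_lt (max_lt ?_ ?_)
    · rw [norm_natCast_padicComplex]; exact Padic.norm_p_lt_one
    · exact (IsUltrametricDist.norm_sum_le_of_forall_le_of_nonneg (norm_nonneg _)
        fun i _ => norm_pow_sub_one_le hu1 i).trans_lt hu
  have h := norm_eq_one_of_norm_sub_one_lt key
  rw [norm_neg] at h
  rw [← geom_sum_mul, norm_mul, h, one_mul]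

lemma pred_prime_ne_zero : p - 1 ≠ 0 := by have := (Fact.out : p.Prime).one_lt; omega

lemma norm_eq_one_of_pow_eq_one {w : ℂ_[p]} (h : w ^ (p - 1) = 1) : ‖w‖ = 1 := by
  have := congrArg norm h
  rw [norm_pow, norm_one] at this
  exact (pow_eq_one_iff_of_nonneg (norm_nonneg _) pred_prime_ne_zero).mp this

lemma ne_zero_of_norm_eq_one {w : ℂ_[p]} (h : ‖w‖ = 1) : w ≠ 0 := by
  rintro rfl; simp at h

lemma rootOfUnity_eq_of_norm_sub_lt {v w : ℂ_[p]} (hv : v ^ (p - 1) = 1) (hw : w ^ (p - 1) = 1)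
    (h : ‖v - w‖ < 1) : v = w := by
  have hw1 := norm_eq_one_of_pow_eq_one hw
  have hw0 := ne_zero_of_norm_eq_one hw1
  have h1 : ‖v / w - 1‖ < 1 := by
    rw [div_sub_one hw0, norm_div, hw1, div_one]; exact h
  have h2 := norm_pow_prime_sub_one h1
  rw [div_pow, hv, hw, div_one, sub_self, norm_zero] at h2
  exact (div_eq_one_iff_eq hw0).mp (sub_eq_zero.mp (norm_eq_zero.mp h2.symm))

variable {x y : ℤ_[p]}

lemma teich_pow (hx : IsUnit x) : teich p x ^ (p - 1) = 1 := by
  rw [teich, dif_pos hx]; exact (exists_teichmuller p x hx).choose_spec.1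

lemma norm_sub_teich (hx : IsUnit x) : ‖toCp p x - teich p x‖ < 1 := by
  rw [teich, dif_pos hx]; exact (exists_teichmuller p x hx).choose_spec.2

lemma norm_teich (hx : IsUnit x) : ‖teich p x‖ = 1 := norm_eq_one_of_pow_eq_one (teich_pow hx)

lemma teich_ne_zero (hx : IsUnit x) : teich p x ≠ 0 := ne_zero_of_norm_eq_one (norm_teich hx)

lemma norm_toCp_unit (hx : IsUnit x) : ‖toCp p x‖ = 1 := by
  rw [norm_toCp, PadicInt.isUnit_iff.mp hx]

lemma teich_eq (hx : IsUnit x) {w : ℂ_[p]} (hw : w ^ (p - 1) = 1) (h : ‖toCp p x - w‖ < 1) :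
    teich p x = w := by
  refine rootOfUnity_eq_of_norm_sub_lt (teich_pow hx) hw ?_
  have : teich p x - w = -(toCp p x - teich p x) + (toCp p x - w) := by ring
  rw [this]
  refine (IsUltrametricDist.norm_add_le_max _ _).trans_lt (max_lt ?_ h)
  rw [norm_neg]; exact norm_sub_teich hx

lemma teich_mul (hx : IsUnit x) (hy : IsUnit y) : teich p (x * y) = teich p x * teich p y := by
  refine teich_eq (hx.mul hy) (by rw [mul_pow, teich_pow hx, teich_pow hy, one_mul]) ?_
  have : toCp p (x * y) - teich p x * teich p y =
      (toCp p x - teich p x) * toCp p y + teich p x * (toCp p y - teich p y) := by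
    rw [toCp_mul]; ring
  rw [this]
  refine (IsUltrametricDist.norm_add_le_max _ _).trans_lt (max_lt ?_ ?_)
  · rw [norm_mul, norm_toCp_unit hy, mul_one]; exact norm_sub_teich hx
  · rw [norm_mul, norm_teich hx, one_mul]; exact norm_sub_teich hy

lemma teich_eq_one (hx : ‖x - 1‖ < 1) (hx' : IsUnit x) : teich p x = 1 :=
  teich_eq hx' (one_pow _) (by rwa [← toCp_one, ← toCp_sub, norm_toCp])

lemma teich_neg_one (hp : p ≠ 2) : teich p (-1) = -1 := by
  have h : toCp p (-1) = -1 := by rw [toCp_eq_hom, map_neg, map_one]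
  refine teich_eq isUnit_one.neg ?_ (by rw [h, sub_self, norm_zero]; exact one_pos)
  exact ((Fact.out : p.Prime).even_sub_one hp).neg_one_pow

lemma norm_angle_sub_one_lt_one (hx : IsUnit x) : ‖angle p x - 1‖ < 1 := by
  rw [angle, div_sub_one (teich_ne_zero hx), norm_div, norm_teich hx, div_one]
  exact norm_sub_teich hx

lemma norm_le_inv_of_norm_lt_one {x : ℤ_[p]} (h : ‖x‖ < 1) : ‖x‖ ≤ (p : ℝ)⁻¹ := by
  have := (PadicInt.norm_le_pow_iff_norm_lt_pow_add_one x (-1)).mpr (by simpa using h)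
  simpa using this

/-- Norms in `ℂ_p` are not discrete, so `< 1` does not give `≤ 1/p` directly. But `⟨x⟩^(p-1) =
x^(p-1)` lies in `ℤ_p`, where it does, and raising to the power `p - 1` preserves the distance to
`1`. -/
lemma norm_angle_sub_one_le (hx : IsUnit x) : ‖angle p x - 1‖ ≤ (p : ℝ)⁻¹ := by
  have h1 := norm_angle_sub_one_lt_one hx
  have h2 : angle p x ^ (p - 1) - 1 = toCp p (x ^ (p - 1) - 1) := by
    rw [angle, div_pow, teich_pow hx, div_one, toCp_sub, toCp_pow, toCp_one]
  rw [← norm_pow_prime_sub_one h1, h2, norm_toCp]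
  rw [← norm_pow_prime_sub_one h1, h2, norm_toCp] at h1
  exact norm_le_inv_of_norm_lt_one h1

lemma angle_mul (hx : IsUnit x) (hy : IsUnit y) : angle p (x * y) = angle p x * angle p y := by
  rw [angle, angle, angle, teich_mul hx hy, toCp_mul, mul_div_mul_comm]

lemma teich_mul_angle (hx : IsUnit x) : teich p x * angle p x = toCp p x :=
  mul_div_cancel₀ _ (teich_ne_zero hx)

variable (p) in
/-- The radius `p^{(p-2)/(p-1)}` of the disc of admissible exponents. -/
def exponentRadius : ℝ := (p : ℝ) ^ (((p : ℝ) - 2) / ((p : ℝ) - 1))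

/-- This is where the disc of exponents comes from: with `‖⟨x⟩ - 1‖ ≤ 1/p`, it is exactly what puts
`s log⟨x⟩` in the disc of the exponential. -/
lemma inv_mul_exponentRadius : (p : ℝ)⁻¹ * exponentRadius p = expRadius p := by
  have h := one_lt_cast_prime (p := p)
  have h0 : (0 : ℝ) < p := by linarith
  have h1 : (p : ℝ) - 1 ≠ 0 := by linarith
  rw [exponentRadius, expRadius, ← Real.rpow_neg_one, ← Real.rpow_add h0]
  congr 1
  field_simp
  ring

lemma one_lt_exponentRadius (hp : p ≠ 2) : 1 < exponentRadius p := by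
  have h2 : (2 : ℝ) < p := by
    have := (Fact.out : p.Prime).two_le
    exact_mod_cast (by omega : 2 < p)
  exact Real.one_lt_rpow (by linarith) (div_pos (by linarith) (by linarith))

lemma inv_lt_expRadius (hp : p ≠ 2) : (p : ℝ)⁻¹ < expRadius p := by
  rw [← inv_mul_exponentRadius]
  have h := one_lt_cast_prime (p := p)
  exact lt_mul_of_one_lt_right (by positivity) (one_lt_exponentRadius hp)

variable {s t : ℂ_[p]}

lemma norm_one_sub_lt (hp : p ≠ 2) (hs : ‖s‖ < exponentRadius p) :
    ‖1 - s‖ < exponentRadius p := by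
  rw [sub_eq_add_neg]
  refine (IsUltrametricDist.norm_add_le_max _ _).trans_lt (max_lt ?_ ?_)
  · rw [norm_one]; exact one_lt_exponentRadius hp
  · rwa [norm_neg]

lemma norm_angle_sub_one_lt (hp : p ≠ 2) (hx : IsUnit x) : ‖angle p x - 1‖ < expRadius p :=
  (norm_angle_sub_one_le hx).trans_lt (inv_lt_expRadius hp)

lemma norm_mul_padicLog_lt (hp : p ≠ 2) (hs : ‖s‖ < exponentRadius p) {u : ℂ_[p]}
    (hu : ‖u - 1‖ ≤ (p : ℝ)⁻¹) : ‖s * padicLog p u‖ < expRadius p := by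
  have h := one_lt_cast_prime (p := p)
  rw [norm_mul, norm_padicLog (hu.trans_lt (inv_lt_expRadius hp)), ← inv_mul_exponentRadius, mul_comm]
  calc ‖u - 1‖ * ‖s‖ ≤ (p : ℝ)⁻¹ * ‖s‖ := by gcongr
    _ < _ := by gcongr

lemma anglePow_mul (hp : p ≠ 2) (hs : ‖s‖ < exponentRadius p) (hx : IsUnit x) (hy : IsUnit y) :
    anglePow p (x * y) s = anglePow p x s * anglePow p y s := by
  rw [anglePow, anglePow, anglePow, angle_mul hx hy,
    padicLog_mul (norm_angle_sub_one_lt hp hx) (norm_angle_sub_one_lt hp hy), mul_add,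
    exp_add_of_norm_lt (norm_mul_padicLog_lt hp hs (norm_angle_sub_one_le hx))
      (norm_mul_padicLog_lt hp hs (norm_angle_sub_one_le hy))]

lemma anglePow_add (hp : p ≠ 2) (hs : ‖s‖ < exponentRadius p) (ht : ‖t‖ < exponentRadius p)
    (hx : IsUnit x) : anglePow p x (s + t) = anglePow p x s * anglePow p x t := by
  rw [anglePow, add_mul, exp_add_of_norm_lt (norm_mul_padicLog_lt hp hs (norm_angle_sub_one_le hx))
      (norm_mul_padicLog_lt hp ht (norm_angle_sub_one_le hx)), anglePow, anglePow]

lemma anglePow_one (hp : p ≠ 2) (hx : IsUnit x) : anglePow p x 1 = angle p x := by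
  rw [anglePow, one_mul, exp_padicLog (norm_angle_sub_one_lt hp hx)]

lemma anglePow_zero : anglePow p x 0 = 1 := by
  rw [anglePow, zero_mul, NormedSpace.exp_zero]

lemma norm_intCast_lt (hp : p ≠ 2) (k : ℤ) : ‖(k : ℂ_[p])‖ < exponentRadius p := by
  refine lt_of_le_of_lt ?_ (one_lt_exponentRadius hp)
  rw [← map_intCast (algebraMap ℚ_[p] ℂ_[p]), norm_algebraMap']
  exact Padic.norm_int_le_one k

lemma anglePow_natCast (hp : p ≠ 2) (hx : IsUnit x) (n : ℕ) :
    anglePow p x n = angle p x ^ n := by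
  have h := norm_mul_padicLog_lt hp (s := 1) (by simpa using one_lt_exponentRadius hp)
    (norm_angle_sub_one_le hx)
  rw [one_mul] at h
  rw [anglePow, exp_natCast_mul h, exp_padicLog (norm_angle_sub_one_lt hp hx)]

lemma anglePow_intCast (hp : p ≠ 2) (hx : IsUnit x) (k : ℤ) :
    anglePow p x k = angle p x ^ k := by
  obtain ⟨n, rfl | rfl⟩ := k.eq_nat_or_neg
  · rw [zpow_natCast, Int.cast_natCast, anglePow_natCast hp hx]
  · have h := anglePow_add (x := x) hp (norm_intCast_lt hp (-n)) (norm_intCast_lt hp n) hx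
    rw [← Int.cast_add, neg_add_cancel, Int.cast_zero, anglePow_zero, Int.cast_natCast,
      anglePow_natCast hp hx] at h
    rw [zpow_neg, zpow_natCast]
    exact eq_inv_of_mul_eq_one_left h.symm

lemma norm_anglePow (hp : p ≠ 2) (hs : ‖s‖ < exponentRadius p) (hx : IsUnit x) :
    ‖anglePow p x s‖ = 1 := by
  have h := norm_mul_padicLog_lt hp hs (norm_angle_sub_one_le hx)
  refine norm_eq_one_of_norm_sub_one_lt ?_
  rw [anglePow, norm_exp_sub_one h]
  exact h.trans expRadius_lt_one

/-! #### Powers with exponents in `ℤ / (p - 1)` -/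

lemma neZero_pred_prime : NeZero (p - 1) := ⟨pred_prime_ne_zero⟩

lemma pow_eq_pow_of_natCast_eq {M : Type*} [Monoid M] {q : ℕ} {w : M} (hw : w ^ q = 1) {a b : ℕ}
    (h : (a : ZMod q) = b) : w ^ a = w ^ b := by
  have := (ZMod.natCast_eq_natCast_iff a b q).mp h
  rw [← Nat.div_add_mod a q, ← Nat.div_add_mod b q, this, pow_add, pow_add, pow_mul,
    pow_mul, hw, one_pow, one_pow]

lemma pow_val_add {M : Type*} [Monoid M] {w : M} (hw : w ^ (p - 1) = 1) (j k : ZMod (p - 1)) :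
    w ^ (j + k).val = w ^ j.val * w ^ k.val := by
  have := neZero_pred_prime (p := p)
  rw [← pow_add]
  exact pow_eq_pow_of_natCast_eq hw (by simp)

lemma pow_val_one {M : Type*} [Monoid M] {w : M} (hw : w ^ (p - 1) = 1) :
    w ^ (1 : ZMod (p - 1)).val = w := by
  have := neZero_pred_prime (p := p)
  conv_rhs => rw [← pow_one w]
  exact pow_eq_pow_of_natCast_eq hw (by simp)

lemma pow_val_intCast {G : Type*} [DivisionRing G] {w : G} (hw : w ^ (p - 1) = 1) (k : ℤ) :
    w ^ ((k : ZMod (p - 1))).val = w ^ k := by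
  have := neZero_pred_prime (p := p)
  have hnat : ∀ n : ℕ, w ^ ((n : ZMod (p - 1))).val = w ^ n := fun n =>
    pow_eq_pow_of_natCast_eq hw (by simp)
  obtain ⟨n, rfl | rfl⟩ := k.eq_nat_or_neg
  · rw [Int.cast_natCast, hnat, zpow_natCast]
  · have h := pow_val_add hw ((-n : ℤ) : ZMod (p - 1)) n
    rw [Int.cast_neg, Int.cast_natCast, neg_add_cancel, ZMod.val_zero, pow_zero, hnat] at h
    rw [Int.cast_neg, Int.cast_natCast, zpow_neg, zpow_natCast]
    exact eq_inv_of_mul_eq_one_left h.symm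

variable {i j : ZMod (p - 1)}

lemma kernelFun_mul (hp : p ≠ 2) (hs : ‖s‖ < exponentRadius p) (hx : IsUnit x) (hy : IsUnit y) :
    kernelFun p j s (x * y) = kernelFun p j s x * kernelFun p j s y := by
  rw [kernelFun, kernelFun, kernelFun, teich_mul hx hy, anglePow_mul hp hs hx hy, mul_pow,
    mul_mul_mul_comm]

lemma norm_kernelFun (hp : p ≠ 2) (hs : ‖s‖ < exponentRadius p) (hx : IsUnit x) :
    ‖kernelFun p j s x‖ = 1 := by
  rw [kernelFun, norm_mul, norm_pow, norm_teich hx, one_pow, one_mul, norm_anglePow hp hs hx]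

lemma kernelFun_one_sub (hp : p ≠ 2) (hs : ‖s‖ < exponentRadius p) (hx : IsUnit x) :
    kernelFun p (1 - i) (1 - s) x = toCp p x * kernelFun p (-i) (-s) x := by
  rw [kernelFun, sub_eq_add_neg, sub_eq_add_neg, pow_val_add (teich_pow hx),
    pow_val_one (teich_pow hx), anglePow_add hp (by simpa using one_lt_exponentRadius hp)
    (by rwa [norm_neg]) hx, anglePow_one hp hx, mul_mul_mul_comm, teich_mul_angle hx, kernelFun]

lemma kernelFun_intCast (hp : p ≠ 2) (hx : IsUnit x) (k : ℤ) :
    kernelFun p (k : ZMod (p - 1)) (k : ℂ_[p]) x = toCp p x ^ k := by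
  rw [kernelFun, pow_val_intCast (teich_pow hx), anglePow_intCast hp hx, ← mul_zpow,
    teich_mul_angle hx]

lemma isUnit_one_add {h : ℤ_[p]} (hh : ‖h‖ ≤ (p : ℝ)⁻¹) : IsUnit (1 + h) := by
  rw [PadicInt.isUnit_iff, ← norm_toCp]
  refine norm_eq_one_of_norm_sub_one_lt ?_
  rw [← toCp_one, ← toCp_sub, norm_toCp, add_sub_cancel_left]
  exact hh.trans_lt (inv_lt_one_of_one_lt₀ one_lt_cast_prime)

/-- Near `1` the Teichmüller factor is trivial, so the function is `exp(s log(1 + h))`; the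
quadratic error combines those of `exp` and `log`. -/
lemma norm_kernelFun_one_add_sub_le (hp : p ≠ 2) (hs : ‖s‖ < exponentRadius p) {h : ℤ_[p]}
    (hh : ‖h‖ ≤ (p : ℝ)⁻¹) :
    ‖kernelFun p j s (1 + h) - 1‖ ≤ ‖s‖ * ‖h‖ ∧
    ‖kernelFun p j s (1 + h) - 1 - s * toCp p h‖ ≤
      (‖s‖ + ‖s‖ ^ 2) / expRadius p * ‖h‖ ^ 2 := by
  have hp1 := one_lt_cast_prime (p := p)
  have hlt : ‖h‖ < 1 := hh.trans_lt (inv_lt_one_of_one_lt₀ hp1)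
  have hnorm : ‖(1 + h) - 1‖ < 1 := by simpa using hlt
  have hunit : IsUnit (1 + h) := isUnit_one_add hh
  have hang : angle p (1 + h) = toCp p (1 + h) := by
    rw [angle, teich_eq_one hnorm hunit, div_one]
  have hsub : angle p (1 + h) - 1 = toCp p h := by
    rw [hang, ← toCp_one, ← toCp_sub, add_sub_cancel_left]
  have hK : kernelFun p j s (1 + h) = NormedSpace.exp (s * padicLog p (angle p (1 + h))) := by
    rw [kernelFun, teich_eq_one hnorm hunit, one_pow, one_mul, anglePow]
  have hz := norm_mul_padicLog_lt hp hs (norm_angle_sub_one_le hunit)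
  have hl := norm_padicLog_sub_le (norm_angle_sub_one_lt hp hunit)
  have hl' := norm_padicLog (norm_angle_sub_one_lt hp hunit)
  rw [hsub, norm_toCp] at hl'
  rw [hsub, norm_toCp] at hl
  rw [hK]
  have hr := expRadius_pos (p := p)
  refine ⟨by rw [norm_exp_sub_one hz, norm_mul, hl'], ?_⟩
  set l := padicLog p (angle p (1 + h))
  have : NormedSpace.exp (s * l) - 1 - s * toCp p h =
      (NormedSpace.exp (s * l) - 1 - s * l) + s * (l - toCp p h) := by ring
  rw [this]
  refine (norm_add_le _ _).trans ?_
  have h1 := norm_exp_sub_one_sub_le hz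
  rw [norm_mul s l, hl'] at h1
  rw [norm_mul s (l - _)]
  calc _ ≤ ‖s‖ * ‖h‖ * (‖s‖ * ‖h‖ / expRadius p) + ‖s‖ * (‖h‖ * (‖h‖ / expRadius p)) := by gcongr
    _ = _ := by ring

/-- With `h' = h / x`, multiplicativity transports every local estimate at a unit to one at `1`. -/
lemma add_eq_mul_one_add (hx : IsUnit x) (h : ℤ_[p]) :
    ∃ h', x + h = x * (1 + h') ∧ h = x * h' ∧ ‖h'‖ = ‖h‖ := by
  obtain ⟨u, rfl⟩ := hx
  have hn : ‖((u⁻¹ : ℤ_[p]ˣ) : ℤ_[p])‖ = 1 := PadicInt.isUnit_iff.mp (u⁻¹).isUnit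
  refine ⟨(u⁻¹ : ℤ_[p]ˣ) * h, ?_, ?_, ?_⟩
  · rw [mul_add, mul_one, Units.mul_inv_cancel_left]
  · rw [Units.mul_inv_cancel_left]
  · rw [norm_mul, hn, one_mul]

lemma norm_kernelFun_add_sub_le (hp : p ≠ 2) (hs : ‖s‖ < exponentRadius p) (hx : IsUnit x)
    {h : ℤ_[p]} (hh : ‖h‖ ≤ (p : ℝ)⁻¹) :
    ‖kernelFun p j s (x + h) - kernelFun p j s x‖ ≤ ‖s‖ * ‖h‖ := by
  obtain ⟨h', e, -, hn⟩ := add_eq_mul_one_add hx h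
  rw [← hn] at hh ⊢
  rw [e, kernelFun_mul hp hs hx (isUnit_one_add hh), ← mul_sub_one, norm_mul,
    norm_kernelFun hp hs hx, one_mul]
  exact (norm_kernelFun_one_add_sub_le hp hs hh).1

/-- The derivative of `ω(x)^{1-i} ⟨x⟩^{1-s}` is `(1-s) ω(x)^{-i} ⟨x⟩^{-s}`, uniformly. -/
lemma norm_kernelFun_one_sub_add_sub_le (hp : p ≠ 2) (hs : ‖s‖ < exponentRadius p) (hx : IsUnit x)
    {h : ℤ_[p]} (hh : ‖h‖ ≤ (p : ℝ)⁻¹) :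
    ‖kernelFun p (1 - i) (1 - s) (x + h) - kernelFun p (1 - i) (1 - s) x -
      (1 - s) * toCp p h * kernelFun p (-i) (-s) x‖ ≤
      (‖1 - s‖ + ‖1 - s‖ ^ 2) / expRadius p * ‖h‖ ^ 2 := by
  obtain ⟨h', e, e', hn⟩ := add_eq_mul_one_add hx h
  rw [← hn] at hh ⊢
  have hs' := norm_one_sub_lt hp hs
  rw [e, kernelFun_mul hp hs' hx (isUnit_one_add hh)]
  -- Here `g(x) = x f(x)` and `h = x h'`, so the proposed derivative term factors through `g(x)`.
  have : (1 - s) * toCp p h * kernelFun p (-i) (-s) x =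
      kernelFun p (1 - i) (1 - s) x * ((1 - s) * toCp p h') := by
    rw [kernelFun_one_sub hp hs hx, e', toCp_mul]; ring
  rw [this, ← mul_sub_one, ← mul_sub, norm_mul, norm_kernelFun hp hs' hx, one_mul]
  exact (norm_kernelFun_one_add_sub_le hp hs' hh).2

lemma kernelFun_neg (hp : p ≠ 2) (hs : ‖s‖ < exponentRadius p) (hx : IsUnit x) :
    kernelFun p j s (-x) = (-1) ^ j.val * kernelFun p j s x := by
  have h : angle p (-1) = 1 := by
    rw [angle, teich_neg_one hp, toCp_eq_hom, map_neg, map_one, div_self (neg_ne_zero.mpr one_ne_zero)]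
  have h0 : padicLog p 1 = 0 := by
    have := norm_padicLog (p := p) (u := 1) (by simpa using expRadius_pos)
    simpa using this
  rw [← neg_one_mul, kernelFun_mul hp hs isUnit_one.neg hx]
  congr 1
  rw [kernelFun, teich_neg_one hp, anglePow, h, h0, mul_zero, NormedSpace.exp_zero, mul_one]

lemma isUnit_two (hp : p ≠ 2) : IsUnit (2 : ℤ_[p]) := by
  have := PadicInt.norm_natCast_eq_one_iff (p := p) (n := 2)
  rw [PadicInt.isUnit_iff]
  exact this.mpr ((Nat.coprime_primes Fact.out Nat.prime_two).mpr hp)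

/-- If `D = 0`, the root of unity `ω(2)^(1-i)` is at distance `< 1` from `1`, hence equals `1`. Then
`⟨2⟩^(1-s) = 1`, so `s = 1` or `⟨2⟩ = 1`; the latter would make `2 = ω(2)` a root of unity. -/
lemma eulerTwo_ne_zero (hp : p ≠ 2) (hs : ‖s‖ < exponentRadius p)
    (h : s ≠ 1 ∨ teich p 2 ^ (1 - i).val ≠ 1) : eulerTwo p i s ≠ 0 := by
  have h2 := isUnit_two hp
  have hs' := norm_one_sub_lt hp hs
  have hz := norm_mul_padicLog_lt hp hs' (norm_angle_sub_one_le h2)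
  intro h0
  rw [eulerTwo, sub_eq_zero, kernelFun] at h0
  have hA : ‖anglePow p 2 (1 - s) - 1‖ < 1 := by
    rw [anglePow, norm_exp_sub_one hz]; exact hz.trans expRadius_lt_one
  have hroot : teich p 2 ^ (1 - i).val = 1 := by
    refine rootOfUnity_eq_of_norm_sub_lt ?_ (one_pow _) ?_
    · rw [← pow_mul, mul_comm, pow_mul, teich_pow h2, one_pow]
    · have : teich p 2 ^ (1 - i).val - 1 =
          -(teich p 2 ^ (1 - i).val * (anglePow p 2 (1 - s) - 1)) := by
        rw [mul_sub, ← h0]; ring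
      rw [this, norm_neg, norm_mul, norm_pow, norm_teich h2, one_pow, one_mul]
      exact hA
  have hs1 : s ≠ 1 := h.resolve_right (not_not.mpr hroot)
  rw [hroot, one_mul] at h0
  have h3 : ‖anglePow p 2 (1 - s) - 1‖ = 0 := by rw [← h0, sub_self, norm_zero]
  rw [anglePow, norm_exp_sub_one hz, norm_mul, norm_padicLog (norm_angle_sub_one_lt hp h2),
    mul_eq_zero] at h3
  rcases h3 with h3 | h3
  · exact hs1 (sub_eq_zero.mp (norm_eq_zero.mp h3)).symm
  · have h4 := teich_mul_angle h2
    rw [sub_eq_zero.mp (norm_eq_zero.mp h3), mul_one] at h4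
    have h5 := teich_pow h2
    have h6 : toCp p 2 = ((2 : ℕ) : ℂ_[p]) := toCp_natCast 2
    rw [h4, h6] at h5
    have h7 : 2 ^ (p - 1) = 1 := by exact_mod_cast h5
    rcases Nat.pow_eq_one.mp h7 with h | h
    · omega
    · exact pred_prime_ne_zero h

end Kernel

/-! ### Alternating sums over `0 ≤ a < p^n` -/

section AltSum

variable {p : ℕ} [Fact p.Prime]

/-- `∑_{0 ≤ a < p^n} F(a) (-1)^a / 2`. -/
def altSum (F : ℤ_[p] → ℂ_[p]) (n : ℕ) : ℂ_[p] :=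
  ∑ a ∈ Finset.range (p ^ n), F a * ((-1) ^ a / 2)

/-- `F` varies by at most `ε` on each ball of radius `p^{-n}`. -/
def OscLE (F : ℤ_[p] → ℂ_[p]) (n : ℕ) (ε : ℝ) : Prop :=
  ∀ x y : ℤ_[p], (p : ℤ_[p]) ^ n ∣ x - y → ‖F x - F y‖ ≤ ε

/-- A quantitative form of uniform continuity on `ℤ_p`. -/
def SmallOsc (F : ℤ_[p] → ℂ_[p]) : Prop := ∀ ε : ℝ, 0 < ε → ∃ n, OscLE F n ε

variable {F G : ℤ_[p] → ℂ_[p]} {n m : ℕ} {ε : ℝ}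

lemma OscLE.mono (h : OscLE F n ε) (hnm : n ≤ m) : OscLE F m ε := fun x y hxy =>
  h x y ((pow_dvd_pow _ hnm).trans hxy)

lemma OscLE.nonneg (h : OscLE F n ε) : 0 ≤ ε := by
  simpa using h 0 0 (by simp)

lemma odd_prime_pow (hp : p ≠ 2) (n : ℕ) : Odd (p ^ n) := ((Fact.out : p.Prime).odd_of_ne_two hp).pow

lemma norm_two (hp : p ≠ 2) : ‖(2 : ℂ_[p])‖ = 1 := by
  have := norm_toCp_unit (isUnit_two hp)
  rwa [show toCp p 2 = 2 from toCp_natCast 2] at this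

lemma norm_neg_one_pow_div_two (hp : p ≠ 2) (a : ℕ) : ‖((-1) ^ a / 2 : ℂ_[p])‖ = 1 := by
  rw [norm_div, norm_pow, norm_neg, norm_one, one_pow, norm_two hp, div_one]

lemma norm_sum_mul_neg_one_pow_le {ι : Type*} (hp : p ≠ 2) (s : Finset ι) (f : ι → ℂ_[p]) (g : ι → ℕ)
    (hε : 0 ≤ ε) (h : ∀ a ∈ s, ‖f a‖ ≤ ε) : ‖∑ a ∈ s, f a * ((-1) ^ g a / 2)‖ ≤ ε := by
  refine IsUltrametricDist.norm_sum_le_of_forall_le_of_nonneg hε fun a ha => ?_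
  rw [norm_mul, norm_neg_one_pow_div_two hp, mul_one]
  exact h a ha

lemma norm_altSum_sub_le_of_forall (hp : p ≠ 2) (hε : 0 ≤ ε) (h : ∀ x, ‖F x - G x‖ ≤ ε) (n : ℕ) :
    ‖altSum F n - altSum G n‖ ≤ ε := by
  rw [altSum, altSum, ← Finset.sum_sub_distrib]
  simp only [← sub_mul]
  exact norm_sum_mul_neg_one_pow_le hp _ _ _ hε fun a _ => h a

lemma sum_range_mul_eq {M : Type*} [AddCommMonoid M] (f : ℕ → M) (q k : ℕ) :
    ∑ a ∈ Finset.range (q * k), f a = ∑ c ∈ Finset.range k, ∑ b ∈ Finset.range q, f (q * c + b) := by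
  induction k with
  | zero => simp
  | succ k ih => rw [mul_add, mul_one, Finset.sum_range_add, ih, Finset.sum_range_succ]

lemma sum_neg_one_pow_of_odd {q : ℕ} (hq : Odd q) :
    ∑ c ∈ Finset.range q, (-1 : ℂ_[p]) ^ c = 1 := by
  obtain ⟨k, rfl⟩ := hq
  induction k with
  | zero => simp
  | succ k ih =>
    rw [show 2 * (k + 1) + 1 = 2 * k + 1 + 1 + 1 by ring, Finset.sum_range_succ,
      Finset.sum_range_succ, ih]
    simp [pow_succ]

lemma norm_altSum_succ_sub_le (hp : p ≠ 2) (h : OscLE F n ε) :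
    ‖altSum F (n + 1) - altSum F n‖ ≤ ε := by
  have hq := odd_prime_pow hp n
  -- Each summand is spread over the `p` residues above it; as `p^n` and `p` are odd, the signs over
  -- `c` add up to `1`.
  have h1 : altSum F n = ∑ c ∈ Finset.range p, ∑ b ∈ Finset.range (p ^ n),
      F b * ((-1) ^ (p ^ n * c + b) / 2) := by
    rw [Finset.sum_comm, altSum]
    refine Finset.sum_congr rfl fun b _ => ?_
    have := sum_neg_one_pow_of_odd (p := p) ((Fact.out : p.Prime).odd_of_ne_two hp)
    simp only [pow_add, pow_mul, hq.neg_one_pow, mul_div_assoc]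
    rw [← Finset.mul_sum, ← Finset.sum_mul, this, one_mul]
  rw [h1, altSum, pow_succ, sum_range_mul_eq, ← Finset.sum_sub_distrib]
  refine IsUltrametricDist.norm_sum_le_of_forall_le_of_nonneg h.nonneg fun c _ => ?_
  rw [← Finset.sum_sub_distrib]
  simp only [← sub_mul]
  refine norm_sum_mul_neg_one_pow_le hp _ _ _ h.nonneg fun b _ => h _ _ ⟨c, ?_⟩
  push_cast; ring

lemma norm_altSum_sub_le (hp : p ≠ 2) (h : OscLE F n ε) (hnm : n ≤ m) :
    ‖altSum F m - altSum F n‖ ≤ ε := by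
  induction m, hnm using Nat.le_induction with
  | base => simpa using h.nonneg
  | succ m hm ih =>
    rw [← sub_add_sub_cancel _ (altSum F m)]
    exact (IsUltrametricDist.norm_add_le_max _ _).trans
      (max_le (norm_altSum_succ_sub_le hp (h.mono hm)) ih)

lemma exists_tendsto_altSum (hp : p ≠ 2) (h : SmallOsc F) :
    ∃ v, Tendsto (altSum F) atTop (𝓝 v) := by
  refine cauchySeq_tendsto_of_complete (Metric.cauchySeq_iff'.mpr fun ε hε => ?_)
  obtain ⟨n, hn⟩ := h (ε / 2) (half_pos hε)
  refine ⟨n, fun m hm => ?_⟩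
  rw [dist_eq_norm]
  exact (norm_altSum_sub_le hp hn hm).trans_lt (half_lt_self hε)

/-- The sums `∑_{0 ≤ a < p^n} F(a)` tend to `0`. -/
lemma tendsto_sum_range_prime_pow (h : SmallOsc F) :
    Tendsto (fun n => ∑ a ∈ Finset.range (p ^ n), F a) atTop (𝓝 0) := by
  rw [Metric.tendsto_atTop]
  intro ε hε
  obtain ⟨n, hn⟩ := h (ε / 2) (half_pos hε)
  set S : ℕ → ℂ_[p] := fun n => ∑ a ∈ Finset.range (p ^ n), F a with hS
  -- Replacing `F` by its values at residues modulo `p^n` repeats the same sum `p^k` times, and `p^k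
  -- → 0`.
  have key : ∀ k, ‖S (n + k) - (p : ℂ_[p]) ^ k * S n‖ ≤ ε / 2 := fun k => by
    have h1 : (p : ℂ_[p]) ^ k * S n =
        ∑ c ∈ Finset.range (p ^ k), ∑ b ∈ Finset.range (p ^ n), F b := by simp [hS]
    rw [h1, hS]
    simp only [pow_add]
    rw [sum_range_mul_eq, ← Finset.sum_sub_distrib]
    refine IsUltrametricDist.norm_sum_le_of_forall_le_of_nonneg hn.nonneg fun c _ => ?_
    rw [← Finset.sum_sub_distrib]
    refine IsUltrametricDist.norm_sum_le_of_forall_le_of_nonneg hn.nonneg fun b _ => hn _ _ ⟨c, ?_⟩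
    push_cast; ring
  have h0 : Tendsto (fun k => (p : ℂ_[p]) ^ k * S n) atTop (𝓝 0) := by
    simpa using (tendsto_prime_pow (p := p)).mul_const (S n)
  obtain ⟨K, hK⟩ := Metric.tendsto_atTop.mp h0 ε hε
  refine ⟨n + K, fun m hm => ?_⟩
  obtain ⟨k, rfl⟩ := Nat.exists_eq_add_of_le ((Nat.le_add_right n K).trans hm)
  have hk := hK k (by omega)
  rw [dist_zero_right] at hk ⊢
  change ‖S (n + k)‖ < ε
  rw [← sub_add_cancel (S (n + k)) ((p : ℂ_[p]) ^ k * S n)]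
  exact (IsUltrametricDist.norm_add_le_max _ _).trans_lt
    (max_lt ((key k).trans_lt (half_lt_self hε)) hk)

/-! ### Doubling residues modulo an odd number, and reflection of alternating sums. -/

lemma sum_range_two_mul_add_one {M : Type*} [AddCommMonoid M] (f : ℕ → M) (k : ℕ) :
    ∑ b ∈ Finset.range (2 * k + 1), f b =
      ∑ a ∈ Finset.range (k + 1), f (2 * a) + ∑ a ∈ Finset.range k, f (2 * a + 1) := by
  induction k with
  | zero => simp
  | succ k ih =>
    rw [show 2 * (k + 1) + 1 = 2 * k + 1 + 1 + 1 by ring, Finset.sum_range_succ,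
      Finset.sum_range_succ, ih, Finset.sum_range_succ _ (k + 1), Finset.sum_range_succ _ k]
    rw [Finset.sum_range_succ (fun a => f (2 * a + 1)) k]
    rw [show 2 * k + 1 + 1 = 2 * (k + 1) by ring]
    abel

/-- Reindexing along multiplication by `2` modulo an odd number `q`. -/
lemma sum_range_two_mul {M : Type*} [AddCommMonoid M] {q : ℕ} (hq : Odd q) (f : ℕ → M) :
    ∑ a ∈ Finset.range q, f (2 * a) =
      ∑ b ∈ Finset.range q, if Even b then f b else f (b + q) := by
  obtain ⟨k, rfl⟩ := hq
  -- For `a ≤ k` the double is an even residue below `q = 2k + 1`; for `a = k + 1 + a'` it is the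
  -- odd residue `2a' + 1` plus `q`.
  calc ∑ a ∈ Finset.range (2 * k + 1), f (2 * a) =
      ∑ a ∈ Finset.range (k + 1), f (2 * a) + ∑ a ∈ Finset.range k, f (2 * (k + 1 + a)) := by
        rw [show 2 * k + 1 = (k + 1) + k by ring, Finset.sum_range_add]
    _ = _ := by
        rw [sum_range_two_mul_add_one (fun b => if Even b then f b else f (b + (2 * k + 1)))]
        congr 1
        · exact Finset.sum_congr rfl fun a _ => by rw [if_pos (even_two_mul a)]
        · refine Finset.sum_congr rfl fun a _ => ?_
          rw [if_neg (by simp), show 2 * (k + 1 + a) = 2 * a + 1 + (2 * k + 1) by ring]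

/-- Alternating sums of even functions tend to `0`. -/
lemma tendsto_altSum_zero_of_even (hp : p ≠ 2) (h : SmallOsc F) (heven : ∀ x, F (-x) = F x)
    (h0 : F 0 = 0) : Tendsto (altSum F) atTop (𝓝 0) := by
  rw [Metric.tendsto_atTop]
  intro ε hε
  obtain ⟨n, hn⟩ := h (ε / 2) (half_pos hε)
  refine ⟨n, fun m hm => ?_⟩
  have hm' := hn.mono hm
  refine lt_of_le_of_lt ?_ (half_lt_self hε)
  rw [dist_zero_right]
  have hq := odd_prime_pow hp m
  have hFq : ‖F ((p ^ m : ℕ) : ℤ_[p])‖ ≤ ε / 2 := by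
    simpa [h0] using hm' ((p ^ m : ℕ) : ℤ_[p]) 0 (by simp)
  -- The endpoint `p^m` is added so that `a ↦ p^m - a` is an involution of the index set. It
  -- reverses the sign, and `F(p^m - a)` is close to `F(-a) = F(a)`; the added value is close to
  -- `F(0) = 0`.
  set A := ∑ a ∈ Finset.range (p ^ m + 1), F a * ((-1) ^ a / 2) with hA
  have h1 : altSum F m = A - F ((p ^ m : ℕ) : ℤ_[p]) * ((-1) ^ (p ^ m) / 2) := by
    rw [hA, Finset.sum_range_succ, altSum, add_sub_cancel_right]
  have h2 : 2 * A = ∑ a ∈ Finset.range (p ^ m + 1), (F a - F ((p ^ m - a : ℕ) : ℤ_[p])) * ((-1) ^ a / 2) := by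
    rw [two_mul]
    conv_lhs => arg 2; rw [hA, ← Finset.sum_range_reflect]
    rw [hA, ← Finset.sum_add_distrib]
    refine Finset.sum_congr rfl fun a ha => ?_
    have ha' : a ≤ p ^ m := Nat.lt_succ_iff.mp (Finset.mem_range.mp ha)
    have hs : (-1 : ℂ_[p]) ^ (p ^ m - a) = -(-1) ^ a := by
      have h3 : (-1 : ℂ_[p]) ^ (p ^ m - a) * (-1) ^ a = -1 := by
        rw [← pow_add, Nat.sub_add_cancel ha', hq.neg_one_pow]
      have h4 : (-1 : ℂ_[p]) ^ a * (-1) ^ a = 1 := by rw [← mul_pow]; simp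
      calc _ = (-1 : ℂ_[p]) ^ (p ^ m - a) * ((-1) ^ a * (-1) ^ a) := by rw [h4, mul_one]
        _ = _ := by rw [← mul_assoc, h3, neg_one_mul]
    rw [Nat.add_sub_cancel, hs]
    ring
  have h3 : ‖A‖ ≤ ε / 2 := by
    rw [← one_mul ‖A‖, ← norm_two hp, ← norm_mul, h2]
    refine norm_sum_mul_neg_one_pow_le hp _ _ _ hm'.nonneg fun a ha => ?_
    have ha' : a ≤ p ^ m := Nat.lt_succ_iff.mp (Finset.mem_range.mp ha)
    rw [← heven a]
    refine hm' _ _ ⟨-1, ?_⟩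
    rw [Nat.cast_sub ha']; push_cast; ring
  rw [h1, sub_eq_add_neg]
  refine (IsUltrametricDist.norm_add_le_max _ _).trans (max_le h3 ?_)
  rwa [norm_neg, norm_mul, norm_neg_one_pow_div_two hp, mul_one]

end AltSum

/-! ### The `p`-adic zeta function as a limit of alternating sums -/

section Zeta

variable {p : ℕ} [Fact p.Prime] {i j : ZMod (p - 1)} {s : ℂ_[p]}

variable (p) in
/-- The function `x ↦ ω(x)^j ⟨x⟩^s` on `ℤ_p^×`, extended by `0`. -/
def kernelExt (j : ZMod (p - 1)) (s : ℂ_[p]) : ℤ_[p] → ℂ_[p] :=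
  Set.indicator {x | IsUnit x} (kernelFun p j s)

lemma kernelExt_of_isUnit {x : ℤ_[p]} (hx : IsUnit x) : kernelExt p j s x = kernelFun p j s x :=
  Set.indicator_of_mem (s := {x | IsUnit x}) hx _

lemma kernelExt_of_not_isUnit {x : ℤ_[p]} (hx : ¬ IsUnit x) : kernelExt p j s x = 0 :=
  Set.indicator_of_notMem (s := {x | IsUnit x}) hx _

lemma isUnit_natCast_iff {m : ℕ} : IsUnit (m : ℤ_[p]) ↔ ¬ p ∣ m := by
  rw [PadicInt.isUnit_iff, PadicInt.norm_natCast_eq_one_iff, (Fact.out : p.Prime).coprime_iff_not_dvd]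

lemma prime_pow_dvd_iff_norm_le {n : ℕ} {h : ℤ_[p]} :
    (p : ℤ_[p]) ^ n ∣ h ↔ ‖h‖ ≤ (p : ℝ)⁻¹ ^ n := by
  rw [← Ideal.mem_span_singleton, ← PadicInt.norm_le_pow_iff_mem_span_pow, zpow_neg, zpow_natCast,
    ← inv_pow]

lemma norm_le_of_prime_pow_dvd {n : ℕ} {h : ℤ_[p]} (hh : (p : ℤ_[p]) ^ n ∣ h) :
    ‖h‖ ≤ (p : ℝ)⁻¹ ^ n := prime_pow_dvd_iff_norm_le.mp hh

lemma inv_prime_pow_le {n : ℕ} (hn : 1 ≤ n) : (p : ℝ)⁻¹ ^ n ≤ (p : ℝ)⁻¹ :=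
  pow_le_of_le_one (by positivity) (inv_le_one_of_one_le₀ one_lt_cast_prime.le) (by omega)

lemma isUnit_iff_of_dvd_sub {n : ℕ} (hn : 1 ≤ n) {x y : ℤ_[p]} (h : (p : ℤ_[p]) ^ n ∣ x - y) :
    IsUnit x ↔ IsUnit y := by
  have aux : ∀ {x y : ℤ_[p]}, (p : ℤ_[p]) ^ n ∣ x - y → IsUnit y → IsUnit x := by
    intro x y h hy
    obtain ⟨h', e, -, hn'⟩ := add_eq_mul_one_add hy (x - y)
    rw [add_sub_cancel] at e
    rw [e]
    refine hy.mul (isUnit_one_add ?_)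
    rw [hn']
    exact (norm_le_of_prime_pow_dvd h).trans (inv_prime_pow_le hn)
  refine ⟨aux ?_, aux h⟩
  rw [← neg_sub]; exact (dvd_neg).mpr h

lemma oscLE_kernelExt (hp : p ≠ 2) (hs : ‖s‖ < exponentRadius p) {n : ℕ} (hn : 1 ≤ n) :
    OscLE (kernelExt p j s) n (‖s‖ * (p : ℝ)⁻¹ ^ n) := by
  intro x y hxy
  by_cases hy : IsUnit y
  · have hx := (isUnit_iff_of_dvd_sub hn hxy).mpr hy
    rw [kernelExt_of_isUnit hx, kernelExt_of_isUnit hy]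
    have hle := norm_le_of_prime_pow_dvd hxy
    have h1 := norm_kernelFun_add_sub_le (j := j) hp hs hy (hle.trans (inv_prime_pow_le hn))
    rw [add_sub_cancel] at h1
    exact h1.trans (by gcongr)
  · have hx := mt (isUnit_iff_of_dvd_sub hn hxy).mp hy
    rw [kernelExt_of_not_isUnit hx, kernelExt_of_not_isUnit hy, sub_zero, norm_zero]
    have := one_lt_cast_prime (p := p)
    positivity

lemma tendsto_inv_prime_pow (C : ℝ) : Tendsto (fun n : ℕ => C * (p : ℝ)⁻¹ ^ n) atTop (𝓝 0) := by
  have h := one_lt_cast_prime (p := p)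
  simpa using (tendsto_pow_atTop_nhds_zero_of_lt_one (by positivity)
    (inv_lt_one_of_one_lt₀ h)).const_mul C

lemma smallOsc_kernelExt (hp : p ≠ 2) (hs : ‖s‖ < exponentRadius p) :
    SmallOsc (kernelExt p j s) := by
  intro ε hε
  obtain ⟨n, hn, hn1⟩ := (((tendsto_inv_prime_pow (p := p) ‖s‖).eventually (gt_mem_nhds hε)).and
    (eventually_ge_atTop 1)).exists
  exact ⟨n, fun x y hxy => (oscLE_kernelExt hp hs hn1 x y hxy).trans hn.le⟩

variable (p) in
/-- The limit of the alternating sums of `ω(x)^{-i} ⟨x⟩^{-s}`. -/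
def altLim (i : ZMod (p - 1)) (s : ℂ_[p]) : ℂ_[p] :=
  limUnder atTop (altSum (kernelExt p (-i) (-s)))

lemma tendsto_altLim (hp : p ≠ 2) (hs : ‖s‖ < exponentRadius p) :
    Tendsto (altSum (kernelExt p (-i) (-s))) atTop (𝓝 (altLim p i s)) := by
  obtain ⟨v, hv⟩ := exists_tendsto_altSum hp
    (smallOsc_kernelExt (p := p) (j := -i) (s := -s) hp (by rwa [norm_neg]))
  rw [altLim, hv.limUnder_eq]
  exact hv

lemma sum_units_eq_sum_kernelExt (n : ℕ) :
    ∑ m ∈ Finset.range (p ^ n) with ¬ p ∣ m, kernelFun p j s m =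
      ∑ m ∈ Finset.range (p ^ n), kernelExt p j s m := by
  rw [Finset.sum_filter]
  refine Finset.sum_congr rfl fun m _ => ?_
  split_ifs with h
  · rw [kernelExt_of_not_isUnit]
    rwa [isUnit_natCast_iff, not_not]
  · rw [kernelExt_of_isUnit]
    rwa [isUnit_natCast_iff]

lemma kernelExt_two_mul (hp : p ≠ 2) (hs : ‖s‖ < exponentRadius p) (x : ℤ_[p]) :
    kernelExt p j s (2 * x) = kernelFun p j s 2 * kernelExt p j s x := by
  have h2 := isUnit_two hp
  by_cases hx : IsUnit x
  · rw [kernelExt_of_isUnit hx, kernelExt_of_isUnit (h2.mul hx), kernelFun_mul hp hs h2 hx]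
  · rw [kernelExt_of_not_isUnit hx, kernelExt_of_not_isUnit (fun h => hx (isUnit_of_mul_isUnit_right h)),
      mul_zero]

lemma norm_kernelExt_add_sub_le (hp : p ≠ 2) (hs : ‖s‖ < exponentRadius p) {n : ℕ} (hn : 1 ≤ n)
    (x : ℤ_[p]) :
    ‖kernelExt p (1 - i) (1 - s) (x + (p : ℤ_[p]) ^ n) - kernelExt p (1 - i) (1 - s) x -
      (1 - s) * (p : ℂ_[p]) ^ n * kernelExt p (-i) (-s) x‖ ≤
      (‖1 - s‖ + ‖1 - s‖ ^ 2) / expRadius p * ((p : ℝ)⁻¹ ^ n) ^ 2 := by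
  have hd : (p : ℤ_[p]) ^ n ∣ (x + (p : ℤ_[p]) ^ n) - x := by simp
  have hle := norm_le_of_prime_pow_dvd (dvd_refl ((p : ℤ_[p]) ^ n))
  have hr := expRadius_pos (p := p)
  have hp1 := one_lt_cast_prime (p := p)
  by_cases hx : IsUnit x
  · rw [kernelExt_of_isUnit hx, kernelExt_of_isUnit hx,
      kernelExt_of_isUnit ((isUnit_iff_of_dvd_sub hn hd).mpr hx)]
    have h1 := norm_kernelFun_one_sub_add_sub_le (i := i) hp hs hx (hle.trans (inv_prime_pow_le hn))
    rw [toCp_pow, show toCp p (p : ℤ_[p]) = p from toCp_natCast p] at h1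
    exact h1.trans (by gcongr)
  · rw [kernelExt_of_not_isUnit hx, kernelExt_of_not_isUnit hx,
      kernelExt_of_not_isUnit (mt (isUnit_iff_of_dvd_sub hn hd).mp hx)]
    simp only [sub_zero, mul_zero, norm_zero]
    positivity

/-- The Volkenborn sums of `ω(x)^{1-i} ⟨x⟩^{1-s}` in terms of alternating sums. -/
lemma norm_eulerTwo_mul_volkenborn_sub_le (hp : p ≠ 2) (hs : ‖s‖ < exponentRadius p) {n : ℕ}
    (hn : 1 ≤ n) :
    ‖eulerTwo p i s * ((∑ m ∈ Finset.range (p ^ n) with ¬ p ∣ m, kernelFun p (1 - i) (1 - s) m) /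
        (p : ℂ_[p]) ^ n) -
      (1 - s) * (altSum (kernelExt p (-i) (-s)) n -
        1 / 2 * ∑ m ∈ Finset.range (p ^ n), kernelExt p (-i) (-s) m)‖ ≤
      (‖1 - s‖ + ‖1 - s‖ ^ 2) / expRadius p * (p : ℝ)⁻¹ ^ n := by
  have hs' := norm_one_sub_lt hp hs
  have hq := odd_prime_pow hp n
  have hr := expRadius_pos (p := p)
  have hp1 := one_lt_cast_prime (p := p)
  have h2 : (2 : ℂ_[p]) ≠ 0 := two_ne_zero
  have hpn := prime_pow_ne_zero (p := p) n
  rw [sum_units_eq_sum_kernelExt]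
  set g := kernelExt p (1 - i) (1 - s) with hg
  set F := kernelExt p (-i) (-s) with hF
  have h1 : kernelFun p (1 - i) (1 - s) 2 * ∑ m ∈ Finset.range (p ^ n), g m =
      ∑ b ∈ Finset.range (p ^ n), if Even b then g b else g (b + (p : ℤ_[p]) ^ n) := by
    have := sum_range_two_mul hq (fun m => g (m : ℤ_[p]))
    simp only [Nat.cast_add, Nat.cast_pow] at this
    rw [← this, Finset.mul_sum]
    refine Finset.sum_congr rfl fun m _ => ?_
    rw [Nat.cast_mul, Nat.cast_ofNat, hg, kernelExt_two_mul hp hs']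
  -- Even `b` cancel on both sides. Odd `b` leave the first-order remainder of `g`, of size
  -- `O(p^(-2n))`, which still is `O(p^(-n))` after division by `p^n`.
  have h3 : eulerTwo p i s * ((∑ m ∈ Finset.range (p ^ n), g m) / (p : ℂ_[p]) ^ n) -
      (1 - s) * (altSum F n - 1 / 2 * ∑ m ∈ Finset.range (p ^ n), F m) =
      -(∑ b ∈ Finset.range (p ^ n), if Even b then 0 else
        g (b + (p : ℤ_[p]) ^ n) - g b - (1 - s) * (p : ℂ_[p]) ^ n * F b) / (p : ℂ_[p]) ^ n := by
    have h4 : eulerTwo p i s * (∑ m ∈ Finset.range (p ^ n), g m) =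
        ∑ b ∈ Finset.range (p ^ n), (g b - if Even b then g b else g (b + (p : ℤ_[p]) ^ n)) := by
      rw [eulerTwo, sub_mul, one_mul, h1, Finset.sum_sub_distrib]
    rw [← mul_div_assoc, h4, eq_div_iff hpn, sub_mul, div_mul_cancel₀ _ hpn, altSum, Finset.mul_sum,
      ← Finset.sum_sub_distrib, Finset.mul_sum, Finset.sum_mul, ← Finset.sum_sub_distrib,
      ← Finset.sum_neg_distrib]
    refine Finset.sum_congr rfl fun b _ => ?_
    split_ifs with hb
    · rw [hb.neg_one_pow]; ring
    · rw [(Nat.not_even_iff_odd.mp hb).neg_one_pow]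
      field_simp
      ring
  rw [h3, norm_div, norm_neg, norm_prime_pow, div_le_iff₀ (by positivity), mul_assoc, ← pow_two]
  refine IsUltrametricDist.norm_sum_le_of_forall_le_of_nonneg (by positivity) fun b _ => ?_
  split_ifs
  · rw [norm_zero]; positivity
  · exact norm_kernelExt_add_sub_le hp hs hn b

lemma volkenbornUnits_kernelFun (hp : p ≠ 2) (hs : ‖s‖ < exponentRadius p)
    (hD : eulerTwo p i s ≠ 0) :
    volkenbornUnits p (kernelFun p (1 - i) (1 - s)) = (1 - s) * altLim p i s / eulerTwo p i s := by
  have h1 : Tendsto (fun n => (1 - s) * (altSum (kernelExt p (-i) (-s)) n -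
      1 / 2 * ∑ m ∈ Finset.range (p ^ n), kernelExt p (-i) (-s) m)) atTop
      (𝓝 ((1 - s) * altLim p i s)) := by
    have h := (tendsto_altLim (i := i) hp hs).sub ((tendsto_sum_range_prime_pow
      (smallOsc_kernelExt (p := p) (j := -i) (s := -s) hp (by rwa [norm_neg]))).const_mul (1 / 2))
    simpa using h.const_mul (1 - s)
  have h2 := squeeze_zero_norm' ((eventually_ge_atTop 1).mono fun n hn =>
    norm_eulerTwo_mul_volkenborn_sub_le (i := i) hp hs hn)
    (tendsto_inv_prime_pow ((‖1 - s‖ + ‖1 - s‖ ^ 2) / expRadius p))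
  have h3 := (h2.add h1).div_const (eulerTwo p i s)
  simp only [sub_add_cancel, mul_div_cancel_left₀ _ hD, zero_add] at h3
  exact h3.limUnder_eq

lemma neg_one_pow_pred_prime (hp : p ≠ 2) : (-1 : ℂ_[p]) ^ (p - 1) = 1 :=
  ((Fact.out : p.Prime).even_sub_one hp).neg_one_pow

/-- If the sign is `-1`, then `(-1)^(-i) = 1`, so the integrand is even and its alternating sums
tend to `0`. -/
lemma neg_one_pow_val_mul_altLim (hp : p ≠ 2) (hs : ‖s‖ < exponentRadius p) :
    (-1) ^ (i - 1).val * altLim p i s = altLim p i s := by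
  have hw := neg_one_pow_pred_prime hp
  have h1 : (-1 : ℂ_[p]) ^ (i - 1).val * (-1) ^ (-i).val * (-1) = 1 := by
    calc _ = (-1 : ℂ_[p]) ^ (i - 1).val * (-1) ^ (-i).val * (-1) ^ (1 : ZMod (p - 1)).val := by
          rw [pow_val_one hw]
      _ = 1 := by
          rw [← pow_val_add hw, ← pow_val_add hw, show i - 1 + -i + 1 = 0 by ring, ZMod.val_zero,
            pow_zero]
  rcases neg_one_pow_eq_or ℂ_[p] (i - 1).val with h | h
  · rw [h, one_mul]
  · have h2 : (-1 : ℂ_[p]) ^ (-i).val = 1 := by rw [h] at h1; simpa using h1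
    have hs' : ‖-s‖ < exponentRadius p := by rwa [norm_neg]
    have h3 : altLim p i s = 0 := by
      refine tendsto_nhds_unique (tendsto_altLim hp hs) (tendsto_altSum_zero_of_even hp
        (smallOsc_kernelExt hp hs') (fun x => ?_) (kernelExt_of_not_isUnit (by simp)))
      by_cases hx : IsUnit x
      · rw [kernelExt_of_isUnit hx, kernelExt_of_isUnit hx.neg, kernelFun_neg hp hs' hx, h2, one_mul]
      · rw [kernelExt_of_not_isUnit hx, kernelExt_of_not_isUnit (mt (IsUnit.neg_iff x).mp hx)]
    rw [h3, mul_zero]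

lemma zetaAux_eq (hp : p ≠ 2) (hs : ‖s‖ < exponentRadius p) (hs1 : s ≠ 1) :
    zetaAux p i s = -1 / eulerTwo p i s * altLim p i s := by
  have hD := eulerTwo_ne_zero (i := i) hp hs (Or.inl hs1)
  have h1 : s - 1 ≠ 0 := sub_ne_zero.mpr hs1
  rw [zetaAux, volkenbornUnits_kernelFun hp hs hD]
  have : (-1 : ℂ_[p]) ^ (i - 1).val / (s - 1) * ((1 - s) * altLim p i s / eulerTwo p i s) =
      -1 / eulerTwo p i s * ((-1) ^ (i - 1).val * altLim p i s) := by
    field_simp; ring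
  rw [this, neg_one_pow_val_mul_altLim hp hs]

/-! ### Continuity in `s` and the value at `s = 1`. -/

lemma norm_anglePow_sub_one_le (hp : p ≠ 2) (hs : ‖s‖ < exponentRadius p) {x : ℤ_[p]}
    (hx : IsUnit x) : ‖anglePow p x s - 1‖ ≤ ‖s‖ := by
  rw [anglePow, norm_exp_sub_one (norm_mul_padicLog_lt hp hs (norm_angle_sub_one_le hx)), norm_mul,
    norm_padicLog (norm_angle_sub_one_lt hp hx)]
  exact mul_le_of_le_one_right (norm_nonneg _) (norm_angle_sub_one_lt_one hx).le

lemma norm_kernelFun_sub_kernelFun_le (hp : p ≠ 2) {t : ℂ_[p]} (hs : ‖s‖ < exponentRadius p)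
    (hst : ‖t - s‖ < exponentRadius p) {x : ℤ_[p]} (hx : IsUnit x) :
    ‖kernelFun p j t x - kernelFun p j s x‖ ≤ ‖t - s‖ := by
  have : kernelFun p j t x = kernelFun p j s x * anglePow p x (t - s) := by
    rw [kernelFun, kernelFun, mul_assoc, ← anglePow_add hp hs hst hx, add_sub_cancel]
  rw [this, ← mul_sub_one, norm_mul, norm_kernelFun hp hs hx, one_mul]
  exact norm_anglePow_sub_one_le hp hst hx

/-- The integrand is `1`-Lipschitz in `s` uniformly in `x`, and alternating sums do not increase the
sup norm. -/
lemma norm_altLim_sub_le (hp : p ≠ 2) {t : ℂ_[p]} (hs : ‖s‖ < exponentRadius p)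
    (ht : ‖t‖ < exponentRadius p) (hst : ‖t - s‖ < exponentRadius p) :
    ‖altLim p i t - altLim p i s‖ ≤ ‖t - s‖ := by
  refine le_of_tendsto ((tendsto_altLim hp ht).sub (tendsto_altLim hp hs)).norm
    (Eventually.of_forall fun n => norm_altSum_sub_le_of_forall hp (norm_nonneg _) (fun x => ?_) n)
  by_cases hx : IsUnit x
  · rw [kernelExt_of_isUnit hx, kernelExt_of_isUnit hx]
    have e : -t - -s = -(t - s) := by ring
    have := norm_kernelFun_sub_kernelFun_le (j := -i) (s := -s) (t := -t) hp (by rwa [norm_neg])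
      (by rwa [e, norm_neg]) hx
    rwa [e, norm_neg] at this
  · rw [kernelExt_of_not_isUnit hx, kernelExt_of_not_isUnit hx, sub_zero, norm_zero]
    exact norm_nonneg _

lemma tendsto_of_norm_sub_le {f : ℂ_[p] → ℂ_[p]} {a : ℂ_[p]}
    (h : ∀ᶠ t in 𝓝 a, ‖f t - f a‖ ≤ ‖t - a‖) : Tendsto f (𝓝 a) (𝓝 (f a)) := by
  rw [tendsto_iff_norm_sub_tendsto_zero]
  have h0 : Tendsto (fun t : ℂ_[p] => ‖t - a‖) (𝓝 a) (𝓝 0) := by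
    simpa using ((continuous_id.sub continuous_const).norm.tendsto a :
      Tendsto (fun t : ℂ_[p] => ‖t - a‖) (𝓝 a) (𝓝 ‖a - a‖))
  exact squeeze_zero' (Eventually.of_forall fun _ => norm_nonneg _) h h0

/-- `ζ_{p,i}(s) = -D⁻¹ lim_n ∑_{a < p^n, p ∤ a} ω(a)^{-i} ⟨a⟩^{-s} (-1)^a / 2`. -/
lemma zeta_eq (hp : p ≠ 2) (hs : ‖s‖ < exponentRadius p)
    (h : s ≠ 1 ∨ teich p 2 ^ (1 - i).val ≠ 1) :
    zeta p i s = -1 / eulerTwo p i s * altLim p i s := by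
  by_cases hs1 : s = 1
  · subst hs1
    rw [zeta, if_pos rfl]
    have hD := eulerTwo_ne_zero hp hs h
    have hB := one_lt_exponentRadius hp
    have hev : ∀ᶠ t in 𝓝 (1 : ℂ_[p]), ‖t‖ < exponentRadius p ∧ ‖t - 1‖ < exponentRadius p := by
      refine Filter.Eventually.and ?_ ?_
      · exact (continuous_norm.tendsto (1 : ℂ_[p])).eventually (gt_mem_nhds hs)
      · refine ((continuous_id.sub continuous_const).norm.tendsto (1 : ℂ_[p])).eventually
          (gt_mem_nhds ?_)
        simpa using zero_lt_one.trans hB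
    have h1 : Tendsto (altLim p i) (𝓝 1) (𝓝 (altLim p i 1)) :=
      tendsto_of_norm_sub_le (hev.mono fun t ht => norm_altLim_sub_le hp hs ht.1 ht.2)
    have h2 : Tendsto (eulerTwo p i) (𝓝 1) (𝓝 (eulerTwo p i 1)) := by
      refine tendsto_of_norm_sub_le (hev.mono fun t ht => ?_)
      have e : (1 - 1) - (1 - t) = t - 1 := by ring
      have := norm_kernelFun_sub_kernelFun_le (j := 1 - i) (s := 1 - t) (t := 1 - 1) hp
        (norm_one_sub_lt hp ht.1) (by rw [e]; exact ht.2) (isUnit_two hp)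
      rw [e] at this
      rwa [eulerTwo, eulerTwo, sub_sub_sub_cancel_left]
    have h3 := ((tendsto_const_nhds (x := (-1 : ℂ_[p]))).div h2 hD).mul h1
    refine Tendsto.limUnder_eq ((h3.mono_left nhdsWithin_le_nhds).congr' ?_)
    filter_upwards [nhdsWithin_le_nhds hev, self_mem_nhdsWithin] with t ht ht1
    exact (zetaAux_eq hp ht.1 ht1).symm
  · rw [zeta, if_neg hs1, zetaAux_eq hp hs hs1]

end Zeta

/-! ### The regularized Bernoulli measure -/

section RegBernoulli

variable {p : ℕ} [Fact p.Prime]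

/-- `V` is a union of balls `a + p^n ℤ_p`. -/
def IsUnionOfBalls (V : Set ℤ_[p]) (n : ℕ) : Prop :=
  ∀ x y : ℤ_[p], (p : ℤ_[p]) ^ n ∣ x - y → (x ∈ V ↔ y ∈ V)

lemma IsUnionOfBalls.mono {V : Set ℤ_[p]} {n m : ℕ} (h : IsUnionOfBalls V n) (hnm : n ≤ m) :
    IsUnionOfBalls V m := fun x y hxy => h x y ((pow_dvd_pow _ hnm).trans hxy)

/-- A Lebesgue number of the open cover `{V, Vᶜ}` of the compact space `ℤ_p` gives one radius valid
at all points. -/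
lemma exists_isUnionOfBalls {V : Set ℤ_[p]} (hV : IsClopen V) : ∃ n, IsUnionOfBalls V n := by
  obtain ⟨δ, hδ, h⟩ := lebesgue_number_lemma_of_metric_sUnion (c := {V, Vᶜ})
    (isCompact_univ (X := ℤ_[p])) (by
      rintro t (rfl | rfl)
      · exact hV.isOpen
      · exact hV.compl.isOpen) (by simp)
  obtain ⟨n, hn⟩ := ((tendsto_inv_prime_pow (p := p) 1).eventually (gt_mem_nhds hδ)).exists
  refine ⟨n, fun x y hxy => ?_⟩
  have hd : x ∈ Metric.ball y δ := by
    rw [Metric.mem_ball, dist_eq_norm]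
    exact (prime_pow_dvd_iff_norm_le.mp hxy).trans_lt (by simpa using hn)
  obtain ⟨t, ht, hb⟩ := h y (Set.mem_univ y)
  have hy := hb (Metric.mem_ball_self hδ)
  have hx := hb hd
  rcases ht with rfl | rfl
  · exact iff_of_true hx hy
  · exact iff_of_false hx hy

lemma IsUnionOfBalls.compl {V : Set ℤ_[p]} {n : ℕ} (h : IsUnionOfBalls V n) :
    IsUnionOfBalls Vᶜ n := fun x y hxy => not_congr (h x y hxy)

lemma IsUnionOfBalls.isOpen {V : Set ℤ_[p]} {n : ℕ} (h : IsUnionOfBalls V n) : IsOpen V := by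
  rw [Metric.isOpen_iff]
  intro x hx
  have h1 := one_lt_cast_prime (p := p)
  refine ⟨(p : ℝ)⁻¹ ^ n, by positivity, fun y hy => ?_⟩
  rw [Metric.mem_ball, dist_eq_norm] at hy
  exact (h y x (prime_pow_dvd_iff_norm_le.mpr hy.le)).mpr hx

lemma IsUnionOfBalls.isClopen {V : Set ℤ_[p]} {n : ℕ} (h : IsUnionOfBalls V n) : IsClopen V :=
  ⟨⟨h.compl.isOpen⟩, h.isOpen⟩

lemma isUnionOfBalls_ball (a : ℤ_[p]) (n : ℕ) : IsUnionOfBalls (ball p a n) n := by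
  intro x y hxy
  change (p : ℤ_[p]) ^ n ∣ x - a ↔ (p : ℤ_[p]) ^ n ∣ y - a
  rw [← sub_add_sub_cancel x y a]
  exact dvd_add_right hxy

lemma isClopen_ball (a : ℤ_[p]) (n : ℕ) : IsClopen (ball p a n) := (isUnionOfBalls_ball a n).isClopen

variable (p) in
/-- The characteristic function of `V`. -/
def charFun (V : Set ℤ_[p]) : ℤ_[p] → ℂ_[p] := V.indicator (fun _ => 1)

variable {V W : Set ℤ_[p]} {n m : ℕ}

lemma IsUnionOfBalls.charFun_eq (h : IsUnionOfBalls V n) {x y : ℤ_[p]}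
    (hxy : (p : ℤ_[p]) ^ n ∣ x - y) : charFun p V x = charFun p V y := by
  classical
  simp only [charFun, Set.indicator_apply, h x y hxy]

lemma IsUnionOfBalls.oscLE (h : IsUnionOfBalls V n) : OscLE (charFun p V) n 0 := fun x y hxy => by
  rw [h.charFun_eq hxy, sub_self, norm_zero]

lemma IsUnionOfBalls.altSum_eq (hp : p ≠ 2) (h : IsUnionOfBalls V n) (hnm : n ≤ m) :
    altSum (charFun p V) m = altSum (charFun p V) n := by
  have := norm_altSum_sub_le hp h.oscLE hnm
  exact sub_eq_zero.mp (norm_le_zero_iff.mp this)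

open Classical in
lemma bernoulliSum_eq (V : Set ℤ_[p]) (n : ℕ) :
    ∑ a ∈ Finset.range (p ^ n) with ((a : ℕ) : ℤ_[p]) ∈ V, ((a : ℂ_[p]) / (p : ℂ_[p]) ^ n - 1 / 2) =
      ∑ a ∈ Finset.range (p ^ n), charFun p V a * ((a : ℂ_[p]) / (p : ℂ_[p]) ^ n - 1 / 2) := by
  rw [Finset.sum_filter]
  refine Finset.sum_congr rfl fun a _ => ?_
  rw [charFun, Set.indicator_apply]
  split_ifs <;> simp

/-- The distribution relation: averaging `c/p` over `0 ≤ c < p` turns the `p` constants `-1/2` back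
into a single one. Consequently the sequence defining `bernoulliDist` is constant from level `n` on.
-/
lemma IsUnionOfBalls.bernoulliSum_succ (h : IsUnionOfBalls V n) :
    ∑ a ∈ Finset.range (p ^ (n + 1)),
        charFun p V a * ((a : ℂ_[p]) / (p : ℂ_[p]) ^ (n + 1) - 1 / 2) =
      ∑ a ∈ Finset.range (p ^ n), charFun p V a * ((a : ℂ_[p]) / (p : ℂ_[p]) ^ n - 1 / 2) := by
  have hp0 : (p : ℂ_[p]) ≠ 0 := Nat.cast_ne_zero.mpr (Fact.out : p.Prime).ne_zero
  have hg : (∑ c ∈ Finset.range p, (c : ℂ_[p])) * 2 = p * (p - 1) := by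
    have h1 := congrArg (Nat.cast (R := ℂ_[p])) (Finset.sum_range_id_mul_two p)
    rw [Nat.cast_mul, Nat.cast_mul, Nat.cast_sub (Fact.out : p.Prime).one_lt.le] at h1
    simpa using h1
  rw [pow_succ, sum_range_mul_eq, Finset.sum_comm]
  refine Finset.sum_congr rfl fun b _ => ?_
  have h1 : ∀ c : ℕ, charFun p V ((p ^ n * c + b : ℕ) : ℤ_[p]) = charFun p V b := fun c =>
    h.charFun_eq ⟨c, by push_cast; ring⟩
  simp only [h1]
  rw [← Finset.mul_sum]
  congr 1
  have h2 : ∀ c : ℕ, ((p ^ n * c + b : ℕ) : ℂ_[p]) / (p : ℂ_[p]) ^ (n + 1) - 1 / 2 =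
      (c : ℂ_[p]) / p + ((b : ℂ_[p]) / (p : ℂ_[p]) ^ (n + 1) - 1 / 2) := fun c => by
    push_cast; field_simp; ring
  simp only [h2]
  rw [Finset.sum_add_distrib, ← Finset.sum_div, eq_div_of_mul_eq two_ne_zero hg, Finset.sum_const,
    Finset.card_range, nsmul_eq_mul]
  field_simp
  ring

lemma IsUnionOfBalls.bernoulliDist_eq (h : IsUnionOfBalls V n) :
    bernoulliDist p V =
      ∑ a ∈ Finset.range (p ^ n), charFun p V a * ((a : ℂ_[p]) / (p : ℂ_[p]) ^ n - 1 / 2) := by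
  refine Tendsto.limUnder_eq (tendsto_const_nhds.congr' ?_)
  filter_upwards [eventually_ge_atTop n] with m hm
  rw [bernoulliSum_eq]
  induction m, hm using Nat.le_induction with
  | base => rfl
  | succ m hm ih => rw [(h.mono hm).bernoulliSum_succ, ih]

lemma IsUnionOfBalls.half (h : IsUnionOfBalls V n) : IsUnionOfBalls {x | 2 * x ∈ V} n :=
  fun x y hxy => h _ _ (by rw [← mul_sub]; exact hxy.mul_left 2)

/-- `μ(V) = ∑_{a < p^n, a ∈ V} (-1)^a / 2` for `n` large. -/
lemma IsUnionOfBalls.regBernoulli_eq (hp : p ≠ 2) (h : IsUnionOfBalls V n) :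
    regBernoulli p V = altSum (charFun p V) n := by
  have hpn := prime_pow_ne_zero (p := p) n
  rw [regBernoulli, h.bernoulliDist_eq, h.half.bernoulliDist_eq]
  -- In `2 μ₁(½V)` an even `b` gets weight `b/p^n - 1` and an odd one `(b + p^n)/p^n - 1`.
  -- Subtracted from `b/p^n - 1/2` these leave `1/2` and `-1/2`.
  have h1 := sum_range_two_mul (odd_prime_pow hp n)
    (fun c : ℕ => charFun p V (c : ℤ_[p]) * ((c : ℂ_[p]) / (p : ℂ_[p]) ^ n - 1))
  have h2 : 2 * ∑ a ∈ Finset.range (p ^ n),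
      charFun p {x | 2 * x ∈ V} a * ((a : ℂ_[p]) / (p : ℂ_[p]) ^ n - 1 / 2) =
      ∑ a ∈ Finset.range (p ^ n), charFun p V ((2 * a : ℕ) : ℤ_[p]) *
        (((2 * a : ℕ) : ℂ_[p]) / (p : ℂ_[p]) ^ n - 1) := by
    rw [Finset.mul_sum]
    refine Finset.sum_congr rfl fun a _ => ?_
    have : charFun p {x | 2 * x ∈ V} (a : ℤ_[p]) = charFun p V ((2 * a : ℕ) : ℤ_[p]) := by
      push_cast; rfl
    rw [this]
    push_cast
    ring
  rw [h2, h1, altSum, ← Finset.sum_sub_distrib]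
  refine Finset.sum_congr rfl fun b _ => ?_
  split_ifs with hb
  · rw [hb.neg_one_pow]; ring
  · have : charFun p V ((b + p ^ n : ℕ) : ℤ_[p]) = charFun p V b :=
      h.charFun_eq ⟨1, by push_cast; ring⟩
    rw [this, (Nat.not_even_iff_odd.mp hb).neg_one_pow]
    push_cast
    field_simp
    ring

lemma norm_charFun_le (V : Set ℤ_[p]) (x : ℤ_[p]) : ‖charFun p V x‖ ≤ 1 := by
  classical
  rw [charFun, Set.indicator_apply]
  split_ifs <;> simp

lemma norm_regBernoulli_le (hp : p ≠ 2) (hV : IsClopen V) : ‖regBernoulli p V‖ ≤ 1 := by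
  obtain ⟨n, h⟩ := exists_isUnionOfBalls hV
  rw [h.regBernoulli_eq hp, altSum]
  exact norm_sum_mul_neg_one_pow_le hp _ _ _ zero_le_one fun a _ => norm_charFun_le V a

lemma prime_pow_dvd_natCast_sub_natCast_iff {a b : ℕ} (ha : a < p ^ n) (hb : b < p ^ n) :
    (p : ℤ_[p]) ^ n ∣ (a : ℤ_[p]) - b ↔ a = b := by
  refine ⟨fun h => ?_, fun h => by simp [h]⟩
  have h1 : ((a : ℤ) - b : ℤ_[p]) = (((a : ℤ) - b : ℤ) : ℤ_[p]) := by push_cast; ring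
  have h2 : ((p ^ n : ℕ) : ℤ) ∣ (a : ℤ) - b := by
    have := (PadicInt.pow_p_dvd_int_iff n ((a : ℤ) - b)).mp (by push_cast; exact h)
    exact_mod_cast this
  have h3 : (b : ℤ) ≡ a [ZMOD (p ^ n : ℕ)] := (Int.modEq_iff_dvd).mpr h2
  exact (Nat.ModEq.eq_of_lt_of_lt (Int.natCast_modEq_iff.mp h3) hb ha).symm

lemma altSum_charFun_ball {a : ℕ} (ha : a < p ^ n) :
    altSum (charFun p (ball p a n)) n = (-1) ^ a / 2 := by
  rw [altSum, Finset.sum_eq_single_of_mem a (Finset.mem_range.mpr ha)]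
  · have : (a : ℤ_[p]) ∈ ball p a n := by simp [ball]
    rw [charFun, Set.indicator_of_mem this, one_mul]
  · intro b hb hba
    have : (b : ℤ_[p]) ∉ ball p a n := fun h =>
      hba ((prime_pow_dvd_natCast_sub_natCast_iff (Finset.mem_range.mp hb) ha).mp h)
    rw [charFun, Set.indicator_of_notMem this, zero_mul]

lemma regBernoulli_ball (hp : p ≠ 2) {a : ℕ} (ha : a < p ^ n) :
    regBernoulli p (ball p a n) = (-1) ^ a / 2 := by
  rw [(isUnionOfBalls_ball _ _).regBernoulli_eq hp, altSum_charFun_ball ha]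

lemma regBernoulli_empty (hp : p ≠ 2) : regBernoulli p ∅ = 0 := by
  have h : IsUnionOfBalls (∅ : Set ℤ_[p]) 0 := fun _ _ _ => Iff.rfl
  rw [h.regBernoulli_eq hp, altSum]
  simp [charFun]

lemma regBernoulli_union (hp : p ≠ 2) (hV : IsClopen V) (hW : IsClopen W) (hd : Disjoint V W) :
    regBernoulli p (V ∪ W) = regBernoulli p V + regBernoulli p W := by
  obtain ⟨n, hn⟩ := exists_isUnionOfBalls hV
  obtain ⟨m, hm⟩ := exists_isUnionOfBalls hW
  have h1 := hn.mono (le_max_left n m)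
  have h2 := hm.mono (le_max_right n m)
  have h3 : IsUnionOfBalls (V ∪ W) (max n m) := fun x y hxy => or_congr (h1 x y hxy) (h2 x y hxy)
  rw [h1.regBernoulli_eq hp, h2.regBernoulli_eq hp, h3.regBernoulli_eq hp, altSum, altSum, altSum,
    ← Finset.sum_add_distrib]
  refine Finset.sum_congr rfl fun a _ => ?_
  rw [← add_mul, charFun, Set.indicator_union_of_disjoint hd]
  rfl

lemma setNorm_regBernoulli_le (hp : p ≠ 2) (V : Set ℤ_[p]) : setNorm (regBernoulli p) V ≤ 1 := by
  refine iSup_le fun B => iSup_le fun hB => iSup_le fun _ => ?_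
  rw [← ofReal_norm]
  exact ENNReal.ofReal_le_one.mpr (norm_regBernoulli_le hp hB)

/-- A family closed under intersection is directed, so compactness would give a common point if no
member were empty. Continuity of the measure then reduces to `μ(∅) = 0`. -/
lemma exists_empty_mem_of_sInter_eq_empty {X : Type*} [TopologicalSpace X] [CompactSpace X]
    [Nonempty X] {R : Set (Set X)} (hR : ∀ A ∈ R, IsClosed A) (hi : ∀ A ∈ R, ∀ B ∈ R, A ∩ B ∈ R)
    (h : ⋂₀ R = ∅) : ∅ ∈ R := by
  by_contra hne
  have hRne : R.Nonempty := by
    rw [Set.nonempty_iff_ne_empty]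
    rintro rfl
    simp at h
  have := hRne.to_subtype
  have := IsCompact.nonempty_sInter_of_directed_nonempty_isCompact_isClosed (S := R)
    (fun A hA B hB => ⟨A ∩ B, hi A hA B hB, Set.inter_subset_left, Set.inter_subset_right⟩)
    (fun A hA => Set.nonempty_iff_ne_empty.mpr fun h => hne (h ▸ hA))
    (fun A hA => (hR A hA).isCompact) hR
  rw [h] at this
  exact Set.not_nonempty_empty this

lemma isPadicMeasure_regBernoulli (hp : p ≠ 2) : IsPadicMeasure (regBernoulli p) where
  additive _ _ hA hB hd := regBernoulli_union hp hA hB hd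
  bounded A _ := (setNorm_regBernoulli_le hp A).trans_lt ENNReal.one_lt_top
  continuous R hR hi h ε hε := ⟨∅, exists_empty_mem_of_sInter_eq_empty (fun A hA => (hR A hA).isClosed)
    hi h, by rwa [regBernoulli_empty hp, norm_zero]⟩

/-! ### Integration against the regularized Bernoulli measure. -/

lemma mem_ball_appr (x : ℤ_[p]) (n : ℕ) : x ∈ ball p (x.appr n : ℤ_[p]) n :=
  Ideal.mem_span_singleton.mp (x.appr_spec n)

/-- Every clopen neighbourhood contains a ball, whose measure `±1/2` has norm `1` as `p` is odd.
Hence the seminorm of `μ` is the sup norm. -/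
lemma normFun_regBernoulli (hp : p ≠ 2) (x : ℤ_[p]) : normFun (regBernoulli p) x = 1 := by
  refine le_antisymm ((iInf_le _ Set.univ).trans ((iInf_le _ isClopen_univ).trans
    ((iInf_le _ (Set.mem_univ x)).trans (setNorm_regBernoulli_le hp _)))) ?_
  refine le_iInf fun A => le_iInf fun hA => le_iInf fun hx => ?_
  obtain ⟨n, hn⟩ := exists_isUnionOfBalls hA
  have hsub : ball p (x.appr n : ℤ_[p]) n ⊆ A := fun y hy => by
    refine (hn y x ?_).mpr hx
    have := dvd_sub hy (mem_ball_appr x n)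
    simpa using this
  refine le_trans ?_ (le_iSup_of_le _ (le_iSup_of_le (isClopen_ball _ n)
    (le_iSup_of_le hsub le_rfl)))
  rw [regBernoulli_ball hp (x.appr_lt n), ← ofReal_norm, norm_neg_one_pow_div_two hp,
    ENNReal.ofReal_one]

lemma tendsto_altSum_simpleFn (hp : p ≠ 2) (g : SimpleFn ℤ_[p] ℂ_[p]) :
    Tendsto (altSum g.toFun) atTop (𝓝 (g.integral (regBernoulli p))) := by
  have h1 : ∀ n, altSum g.toFun n = ∑ j, g.coeff j * altSum (charFun p (g.sets j)) n := fun n => by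
    simp only [altSum, SimpleFn.toFun, Finset.sum_mul, Finset.mul_sum]
    rw [Finset.sum_comm]
    refine Finset.sum_congr rfl fun j _ => Finset.sum_congr rfl fun a _ => ?_
    classical
    rw [charFun, Set.indicator_apply, Set.indicator_apply]
    split_ifs <;> simp
  rw [show altSum g.toFun = _ from funext h1]
  refine tendsto_finsetSum _ fun j _ => Tendsto.const_mul _ ?_
  obtain ⟨n, hn⟩ := exists_isUnionOfBalls (g.isClopen j)
  rw [hn.regBernoulli_eq hp]
  refine tendsto_const_nhds.congr' ?_
  filter_upwards [eventually_ge_atTop n] with m hm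
  exact (hn.altSum_eq hp hm).symm

lemma norm_le_of_funNorm_le (hp : p ≠ 2) {f : ℤ_[p] → ℂ_[p]} {ε : ℝ} (hε : 0 ≤ ε)
    (h : funNorm (regBernoulli p) f ≤ ENNReal.ofReal ε) (x : ℤ_[p]) : ‖f x‖ ≤ ε := by
  have h1 := (le_iSup (fun x => ‖f x‖ₑ * normFun (regBernoulli p) x) x).trans h
  rw [normFun_regBernoulli hp, mul_one, ← ofReal_norm] at h1
  exact (ENNReal.ofReal_le_ofReal_iff hε).mp h1

/-- Integrals with respect to the regularized Bernoulli measure are limits of alternating sums. -/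
lemma HasPadicIntegral.tendsto_altSum (hp : p ≠ 2) {f : ℤ_[p] → ℂ_[p]} {v : ℂ_[p]}
    (h : HasPadicIntegral (regBernoulli p) f v) : Tendsto (altSum f) atTop (𝓝 v) := by
  obtain ⟨g, hg, hv⟩ := h
  rw [Metric.tendsto_atTop]
  intro ε hε
  have hε2 : 0 < ε / 2 := half_pos hε
  obtain ⟨k, hk1, hk2⟩ := ((hg.eventually (gt_mem_nhds (ENNReal.ofReal_pos.mpr hε2))).and
    (hv.eventually (Metric.ball_mem_nhds v hε))).exists
  obtain ⟨N, hN⟩ := Metric.tendsto_atTop.mp (tendsto_altSum_simpleFn hp (g k)) ε hε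
  refine ⟨N, fun n hn => ?_⟩
  have h1 : ‖altSum f n - altSum (g k).toFun n‖ < ε :=
    (norm_altSum_sub_le_of_forall hp hε2.le
      (norm_le_of_funNorm_le hp hε2.le hk1.le) n).trans_lt (half_lt_self hε)
  rw [← dist_eq_norm] at h1
  exact (dist_triangle_max _ (altSum (g k).toFun n) _).trans_lt
    (max_lt h1 ((dist_triangle_max _ ((g k).integral (regBernoulli p)) _).trans_lt
      (max_lt (hN n hn) hk2)))

/-- The simple function with value `f(a)` on `a + p^k ℤ_p` for `0 ≤ a < p^k`. -/
def ballApprox (f : ℤ_[p] → ℂ_[p]) (k : ℕ) : SimpleFn ℤ_[p] ℂ_[p] where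
  size := p ^ k
  sets j := ball p ((j : ℕ) : ℤ_[p]) k
  isClopen _ := isClopen_ball _ k
  coeff j := f ((j : ℕ) : ℤ_[p])

lemma ballApprox_toFun (f : ℤ_[p] → ℂ_[p]) (k : ℕ) (x : ℤ_[p]) :
    (ballApprox f k).toFun x = f (x.appr k : ℤ_[p]) := by
  change ∑ j : Fin (p ^ k), (ball p ((j : ℕ) : ℤ_[p]) k).indicator (fun _ => f ((j : ℕ) : ℤ_[p])) x = _
  have hx := mem_ball_appr x k
  rw [Finset.sum_eq_single_of_mem (⟨x.appr k, x.appr_lt k⟩ : Fin (p ^ k)) (Finset.mem_univ _)]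
  · exact Set.indicator_of_mem hx _
  · intro j _ hj
    refine Set.indicator_of_notMem (fun h => hj (Fin.ext ?_)) _
    have h1 := dvd_sub h hx
    rw [sub_sub_sub_cancel_left] at h1
    exact ((prime_pow_dvd_natCast_sub_natCast_iff (x.appr_lt k) j.2).mp h1).symm

lemma ballApprox_integral (hp : p ≠ 2) (f : ℤ_[p] → ℂ_[p]) (k : ℕ) :
    (ballApprox f k).integral (regBernoulli p) = altSum f k := by
  change ∑ j : Fin (p ^ k), f ((j : ℕ) : ℤ_[p]) * regBernoulli p (ball p ((j : ℕ) : ℤ_[p]) k) = _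
  rw [altSum, Finset.sum_range]
  exact Finset.sum_congr rfl fun j _ => by rw [regBernoulli_ball hp j.2]

/-- The level-`k` step functions converge uniformly to `f`, and their integrals are exactly the
alternating sums. -/
lemma hasPadicIntegral_of_smallOsc (hp : p ≠ 2) {f : ℤ_[p] → ℂ_[p]} (hf : SmallOsc f) {v : ℂ_[p]}
    (hv : Tendsto (altSum f) atTop (𝓝 v)) : HasPadicIntegral (regBernoulli p) f v := by
  refine ⟨ballApprox f, ?_, ?_⟩
  · rw [ENNReal.tendsto_nhds_zero]
    intro ε hε
    obtain ⟨δ, hδ0, hδ⟩ := ENNReal.lt_iff_exists_nnreal_btwn.mp hε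
    obtain ⟨n, hn⟩ := hf δ (by exact_mod_cast hδ0)
    filter_upwards [eventually_ge_atTop n] with k hk
    refine iSup_le fun x => ?_
    beta_reduce
    rw [normFun_regBernoulli hp, mul_one, ballApprox_toFun]
    refine le_trans ?_ hδ.le
    exact_mod_cast hn.mono hk x _ (mem_ball_appr x k)
  · simp only [ballApprox_integral hp]
    exact hv

variable {i : ZMod (p - 1)} {s : ℂ_[p]}

lemma padicIntegrableOn_kernelFun (hp : p ≠ 2) (hs : ‖s‖ < exponentRadius p) :
    PadicIntegrableOn (regBernoulli p) {x : ℤ_[p] | IsUnit x} (kernelFun p (-i) (-s)) :=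
  ⟨altLim p i s, hasPadicIntegral_of_smallOsc hp
    (smallOsc_kernelExt (j := -i) (s := -s) hp (by rwa [norm_neg])) (tendsto_altLim hp hs)⟩

lemma padicIntegralOn_kernelFun (hp : p ≠ 2) (hs : ‖s‖ < exponentRadius p) :
    padicIntegralOn (regBernoulli p) {x : ℤ_[p] | IsUnit x} (kernelFun p (-i) (-s)) =
      altLim p i s := by
  have h := padicIntegrableOn_kernelFun (i := i) hp hs
  rw [padicIntegralOn, dif_pos h]
  exact tendsto_nhds_unique (h.choose_spec.tendsto_altSum hp) (tendsto_altLim hp hs)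

end RegBernoulli

/-! ### The hyperfinite representation -/

section Hyperfinite

universe u v w

lemma UProd.exists_rep {I : Type u} {U : Ultrafilter I} {A : I → Type v} (y : UProd U A) :
    ∃ a, UProd.mk U a = y := Quotient.exists_rep y

lemma UProd.mk_eq_mk {I : Type u} {U : Ultrafilter I} {A : I → Type v} {a b : ∀ i, A i} :
    UProd.mk U a = UProd.mk U b ↔ ∀ᶠ i in (U : Filter I), a i = b i := Quotient.eq

/-- The dictionary for all that follows: standard parts are limits along the ultrafilter. -/
lemma inMonad_mk {I : Type u} {U : Ultrafilter I} {X : Type v} [TopologicalSpace X] {a : I → X}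
    {x : X} : InMonad (UProd.mk U a) x ↔ Tendsto a U (𝓝 x) := by
  rw [tendsto_nhds]
  rfl

lemma st_eq {I : Type u} {U : Ultrafilter I} {X : Type v} [TopologicalSpace X] [T2Space X]
    [Nonempty X] {y : Star U X} {x : X} (h : InMonad y x) : st y = x := by
  obtain ⟨a, rfl⟩ := UProd.exists_rep y
  have h1 : InMonad (UProd.mk U a) (st (UProd.mk U a)) := Classical.epsilon_spec ⟨x, h⟩
  exact tendsto_nhds_unique (inMonad_mk.mp h1) (inMonad_mk.mp h)

variable {p : ℕ} [Fact p.Prime] {I : Type u} {U : Ultrafilter I} {n : I → ℕ}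

/-- Compactness of `ℤ_p` makes every point of `Y` nearstandard. -/
lemma tendsto_stY (z : ∀ i, ZMod (p ^ n i)) :
    Tendsto (fun i => (((z i).val : ℕ) : ℤ_[p])) U (𝓝 (stY p U n (UProd.mk U z))) := by
  obtain ⟨x, -, hx⟩ := isCompact_univ.ultrafilter_le_nhds
    (U.map fun i => (((z i).val : ℕ) : ℤ_[p])) (by simp)
  have h : InMonad (hyperRep p U n (UProd.mk U z)) x := inMonad_mk.mpr hx
  rw [stY, st_eq h]
  exact hx

lemma eventually_le_of_isInfiniteNat (h : IsInfiniteNat (UProd.mk U n)) (k : ℕ) :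
    ∀ᶠ i in (U : Filter I), k ≤ n i := Eventually.mono (h k) fun _ hi => le_of_lt hi

lemma tendsto_of_isInfiniteNat (h : IsInfiniteNat (UProd.mk U n)) : Tendsto n U atTop :=
  tendsto_atTop.mpr (eventually_le_of_isInfiniteNat h)

instance neZero_prime_pow (k : ℕ) : NeZero (p ^ k) := ⟨pow_ne_zero _ (Fact.out : p.Prime).ne_zero⟩

lemma sum_zmod_val {M : Type*} [AddCommMonoid M] (q : ℕ) [NeZero q] (f : ℕ → M) :
    ∑ z : ZMod q, f z.val = ∑ a ∈ Finset.range q, f a := by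
  refine Finset.sum_bij (fun z _ => z.val) (fun z _ => Finset.mem_range.mpr z.val_lt)
    (fun a _ b _ h => ZMod.val_injective q h) (fun a ha => ?_) (fun _ _ => rfl)
  exact ⟨a, Finset.mem_univ _, ZMod.val_cast_of_lt (Finset.mem_range.mp ha)⟩

lemma eventually_mem_iff_stY_mem {V : Set ℤ_[p]} (hV : IsClopen V) (z : ∀ i, ZMod (p ^ n i)) :
    (∀ᶠ i in (U : Filter I), (((z i).val : ℕ) : ℤ_[p]) ∈ V) ↔ stY p U n (UProd.mk U z) ∈ V := by
  have h := tendsto_stY (U := U) z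
  refine ⟨fun hev => hV.isClosed.mem_of_tendsto h hev, fun hm => h.eventually_mem (hV.isOpen.mem_nhds hm)⟩

open Classical in
/-- The internal set of the points `a + p^N` of `Y` with `a ∈ V`. -/
def internalPreimage (U : Ultrafilter I) (n : I → ℕ) (V : Set ℤ_[p]) :
    UProd U (fun i => Finset (ZMod (p ^ n i))) :=
  UProd.mk U (fun _ => Finset.univ.filter fun z => ((z.val : ℕ) : ℤ_[p]) ∈ V)

lemma isStPreimage_internalPreimage {V : Set ℤ_[p]} (hV : IsClopen V) :
    IsStPreimage p U n (internalPreimage U n V) V := by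
  intro y
  obtain ⟨z, rfl⟩ := UProd.exists_rep y
  rw [← eventually_mem_iff_stY_mem hV]
  refine eventually_congr (Eventually.of_forall fun i => ?_)
  simp

/-- Extensionality of internal sets: if `S i ≠ T i` for almost all `i`, a choice of distinguishing
points defines a point of `Y` on which the two sets disagree. -/
lemma IsStPreimage.ext {S T : UProd U (fun i => Finset (ZMod (p ^ n i)))} {V : Set ℤ_[p]}
    (hS : IsStPreimage p U n S V) (hT : IsStPreimage p U n T V) : S = T := by
  obtain ⟨S, rfl⟩ := UProd.exists_rep S
  obtain ⟨T, rfl⟩ := UProd.exists_rep T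
  rw [UProd.mk_eq_mk]
  by_contra hne
  rw [← Ultrafilter.eventually_not] at hne
  have hex : ∀ i, ∃ z, S i ≠ T i → ¬ (z ∈ S i ↔ z ∈ T i) := fun i => by
    by_cases h : S i = T i
    · exact ⟨0, fun h' => absurd h h'⟩
    · obtain ⟨z, hz⟩ := not_forall.mp (mt Finset.ext h)
      exact ⟨z, fun _ => hz⟩
  choose z hz using hex
  have h1 := (hS (UProd.mk U z)).trans (hT (UProd.mk U z)).symm
  change (∀ᶠ i in (U : Filter I), z i ∈ S i) ↔ (∀ᶠ i in (U : Filter I), z i ∈ T i) at h1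
  have h2 : ∀ᶠ i in (U : Filter I), (z i ∈ S i ↔ z i ∈ T i) := by
    by_cases h : ∀ᶠ i in (U : Filter I), z i ∈ S i
    · filter_upwards [h, h1.mp h] with i h3 h4
      exact iff_of_true h3 h4
    · have h' := mt h1.mpr h
      rw [← Ultrafilter.eventually_not] at h h'
      filter_upwards [h, h'] with i h3 h4
      exact iff_of_false h3 h4
  obtain ⟨i, h3, h4⟩ := (hne.and h2).exists
  exact hz i h3 h4

lemma hyperSum_internalPreimage (hp : p ≠ 2) (hn : IsInfiniteNat (UProd.mk U n)) {V : Set ℤ_[p]}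
    (hV : IsClopen V) :
    hyperSum (internalPreimage U n V) (hyperNu p U n) = Star.const (regBernoulli p V) := by
  obtain ⟨m, hm⟩ := exists_isUnionOfBalls hV
  refine UProd.mk_eq_mk.mpr ?_
  filter_upwards [eventually_le_of_isInfiniteNat hn m] with i hi
  rw [(hm.mono hi).regBernoulli_eq hp, altSum, Finset.sum_filter,
    ← sum_zmod_val (p ^ n i) (fun a => charFun p V (a : ℤ_[p]) * ((-1) ^ a / 2))]
  refine Finset.sum_congr rfl fun z _ => ?_
  classical
  rw [charFun, Set.indicator_apply]
  split_ifs <;> simp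

/-- A set whose inverse image under the standard-part map is internal is open. -/
lemma isOpen_of_isStPreimage (hn : IsInfiniteNat (UProd.mk U n))
    {S : UProd U (fun i => Finset (ZMod (p ^ n i)))} {V : Set ℤ_[p]}
    (hS : IsStPreimage p U n S V) : IsOpen V := by
  obtain ⟨S, rfl⟩ := UProd.exists_rep S
  rw [isOpen_iff_mem_nhds]
  intro x hx
  by_contra hV
  have hex : ∀ k : ℕ, ∃ y, (p : ℤ_[p]) ^ k ∣ y - x ∧ y ∉ V := by
    intro k
    by_contra hk
    push Not at hk
    refine hV (mem_of_superset ((isClopen_ball x k).isOpen.mem_nhds (show (p : ℤ_[p]) ^ k ∣ x - x by simp))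
      fun y hy => hk y hy)
  choose y hyx hyV using hex
  have hval : ∀ (w : ℤ_[p]) (m : ℕ), (p : ℤ_[p]) ^ m ∣ (((w.appr m : ZMod (p ^ m)).val : ℕ) : ℤ_[p]) - w :=
    fun w m => by
      rw [ZMod.val_cast_of_lt (w.appr_lt m), ← neg_sub]
      exact (dvd_neg).mpr (mem_ball_appr w m)
  have hst : ∀ (x : ℤ_[p]) (w : I → ℤ_[p]),
      (∀ k : ℕ, ∀ᶠ i in (U : Filter I), (p : ℤ_[p]) ^ k ∣ w i - x) →
      stY p U n (UProd.mk U fun i => ((w i).appr (n i) : ZMod (p ^ n i))) = x := by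
    intro x w hw
    refine tendsto_nhds_unique (tendsto_stY _) ?_
    rw [Metric.tendsto_nhds]
    intro ε hε
    obtain ⟨k, hk⟩ := ((tendsto_inv_prime_pow (p := p) 1).eventually (gt_mem_nhds hε)).exists
    filter_upwards [hw k, eventually_le_of_isInfiniteNat hn k] with i h1 h2
    rw [dist_eq_norm]
    refine (prime_pow_dvd_iff_norm_le.mp ?_).trans_lt (by simpa using hk)
    have := dvd_add ((pow_dvd_pow _ h2).trans (hval (w i) (n i))) h1
    rwa [sub_add_sub_cancel] at this
  -- Overspill: the residues of each `y k` avoid `S` almost everywhere. Taking the largest such `k ≤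
  -- n i` for each `i` gives an infinite index `K`; the point of `Y` built from `y (K i)` avoids
  -- `S`, although its standard part is `x ∈ V`.
  let P : I → ℕ → Prop := fun i k => (((y k).appr (n i) : ZMod (p ^ n i))) ∉ S i
  have hP : ∀ k, ∀ᶠ i in (U : Filter I), P i k := fun k => by
    rw [Ultrafilter.eventually_not]
    intro h
    have h1 := (hS (UProd.mk U fun i => ((y k).appr (n i) : ZMod (p ^ n i)))).mp h
    rw [hst (y k) (fun _ => y k) (fun _ => by simp)] at h1
    exact hyV k h1
  classical
  let K : I → ℕ := fun i => Nat.findGreatest (P i) (n i)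
  have hK : ∀ k, ∀ᶠ i in (U : Filter I), k ≤ K i ∧ P i (K i) := fun k => by
    filter_upwards [hP k, eventually_le_of_isInfiniteNat hn k] with i h1 h2
    exact ⟨Nat.le_findGreatest h2 h1, Nat.findGreatest_spec h2 h1⟩
  have hx' := hst x (fun i => y (K i)) fun k => (hK k).mono fun i hi =>
    (pow_dvd_pow _ hi.1).trans (hyx _)
  rw [← hx'] at hx
  have h1 : ∀ᶠ i in (U : Filter I), ((y (K i)).appr (n i) : ZMod (p ^ n i)) ∈ S i := (hS _).mpr hx
  obtain ⟨i, h2, h3⟩ := (h1.and (hK 0)).exists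
  exact h3.2 h2

lemma isStPreimage_compl {S : UProd U (fun i => Finset (ZMod (p ^ n i)))} {V : Set ℤ_[p]}
    (hS : IsStPreimage p U n S V) : ∃ T, IsStPreimage p U n T Vᶜ := by
  obtain ⟨S, rfl⟩ := UProd.exists_rep S
  refine ⟨UProd.mk U fun i => (S i)ᶜ, fun y => ?_⟩
  rw [Set.mem_compl_iff, ← hS y]
  obtain ⟨z, rfl⟩ := UProd.exists_rep y
  change (∀ᶠ i in (U : Filter I), z i ∈ (S i)ᶜ) ↔ ¬ ∀ᶠ i in (U : Filter I), z i ∈ S i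
  rw [← Ultrafilter.eventually_not]
  simp only [Finset.mem_compl]

lemma isPushDown_regBernoulli (hp : p ≠ 2) (hn : IsInfiniteNat (UProd.mk U n)) :
    IsPushDown p U n (regBernoulli p) (hyperNu p U n) := by
  refine ⟨fun V => ⟨fun hV => ⟨_, isStPreimage_internalPreimage hV⟩, fun ⟨S, hS⟩ => ?_⟩,
    fun V hV S hS => ?_⟩
  · obtain ⟨T, hT⟩ := isStPreimage_compl hS
    exact ⟨⟨isOpen_of_isStPreimage hn hT⟩, isOpen_of_isStPreimage hn hS⟩
  · rw [hS.ext (isStPreimage_internalPreimage hV)]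
    exact hyperSum_internalPreimage hp hn hV

/-- The case `k = 0` must be excluded: in the zero ring `0` is a unit. -/
lemma isUnit_zmod_prime_pow_iff {k : ℕ} (hk : 1 ≤ k) (z : ZMod (p ^ k)) :
    IsUnit z ↔ IsUnit ((z.val : ℕ) : ℤ_[p]) := by
  rw [isUnit_natCast_iff, ← (Fact.out : p.Prime).coprime_iff_not_dvd, Nat.coprime_comm,
    ← Nat.coprime_pow_right_iff (by omega : 0 < k), ← ZMod.isUnit_iff_coprime, ZMod.natCast_zmod_val]

/-! ### Liftings and hyperfinite integrals. -/

lemma mem_hyperUnits_mk {z : ∀ i, ZMod (p ^ n i)} :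
    UProd.Mem (UProd.mk U z) (hyperUnits p U n) ↔ ∀ᶠ i in (U : Filter I), IsUnit (z i) :=
  eventually_congr (Eventually.of_forall fun i => by simp)

lemma isClopen_isUnit : IsClopen {x : ℤ_[p] | IsUnit x} :=
  IsUnionOfBalls.isClopen (n := 1) fun _ _ h => isUnit_iff_of_dvd_sub le_rfl h

lemma continuous_of_smallOsc {F : ℤ_[p] → ℂ_[p]} (h : SmallOsc F) : Continuous F := by
  rw [continuous_iff_continuousAt]
  intro x
  rw [ContinuousAt, Metric.tendsto_nhds]
  intro ε hε
  obtain ⟨n, hn⟩ := h (ε / 2) (half_pos hε)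
  filter_upwards [(isClopen_ball x n).isOpen.mem_nhds (show (p : ℤ_[p]) ^ n ∣ x - x by simp)] with y hy
  rw [dist_eq_norm]
  exact (hn y x hy).trans_lt (half_lt_self hε)

variable {j : ZMod (p - 1)} {s : ℂ_[p]}

lemma eventually_isUnit_val (hn : IsInfiniteNat (UProd.mk U n)) {z : ∀ i, ZMod (p ^ n i)}
    (hz : ∀ᶠ i in (U : Filter I), IsUnit (z i)) :
    ∀ᶠ i in (U : Filter I), IsUnit (((z i).val : ℕ) : ℤ_[p]) := by
  filter_upwards [hz, eventually_le_of_isInfiniteNat hn 1] with i h1 h2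
  exact (isUnit_zmod_prime_pow_iff h2 _).mp h1

lemma tendsto_kernelFun_val (hp : p ≠ 2) (hs : ‖s‖ < exponentRadius p)
    (hn : IsInfiniteNat (UProd.mk U n)) {z : ∀ i, ZMod (p ^ n i)}
    (hz : ∀ᶠ i in (U : Filter I), IsUnit (z i)) :
    Tendsto (fun i => kernelFun p j s (((z i).val : ℕ) : ℤ_[p])) U
      (𝓝 (kernelFun p j s (stY p U n (UProd.mk U z)))) := by
  have hu := eventually_isUnit_val hn hz
  have hst := (eventually_mem_iff_stY_mem isClopen_isUnit z).mp hu
  rw [← kernelExt_of_isUnit hst]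
  refine (((continuous_of_smallOsc (smallOsc_kernelExt hp hs)).tendsto _).comp
    (tendsto_stY z)).congr' ?_
  filter_upwards [hu] with i hi
  exact kernelExt_of_isUnit hi

lemma isLiftOnUnits_canonicalLift (hp : p ≠ 2) (hs : ‖s‖ < exponentRadius p)
    (hn : IsInfiniteNat (UProd.mk U n)) :
    IsLiftOnUnits p U n (kernelFun p j s) (canonicalLift p U n (kernelFun p j s)) := by
  intro y hy
  obtain ⟨z, rfl⟩ := UProd.exists_rep y
  exact inMonad_mk.mpr (tendsto_kernelFun_val hp hs hn (mem_hyperUnits_mk.mp hy))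

/-- A lifting is uniformly close to the canonical one. -/
lemma eventually_norm_lift_sub_lt (hp : p ≠ 2) (hs : ‖s‖ < exponentRadius p)
    (hn : IsInfiniteNat (UProd.mk U n)) {F : ∀ i, ZMod (p ^ n i) → ℂ_[p]}
    (hF : IsLiftOnUnits p U n (kernelFun p j s) (UProd.mk U F)) {ε : ℝ} (hε : 0 < ε) :
    ∀ᶠ i in (U : Filter I), ∀ z : ZMod (p ^ n i), IsUnit z →
      ‖F i z - kernelFun p j s ((z.val : ℕ) : ℤ_[p])‖ < ε := by
  by_contra hne
  rw [← Ultrafilter.eventually_not] at hne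
  -- A violating unit is chosen at each index where there is one, and `1` elsewhere. Together they
  -- form a point of `Y^×` at which `F` could not be a lifting.
  have hex : ∀ i, ∃ z : ZMod (p ^ n i), IsUnit z ∧ ((¬ ∀ z : ZMod (p ^ n i), IsUnit z →
      ‖F i z - kernelFun p j s ((z.val : ℕ) : ℤ_[p])‖ < ε) →
      ¬ ‖F i z - kernelFun p j s ((z.val : ℕ) : ℤ_[p])‖ < ε) := fun i => by
    by_cases h : ∀ z : ZMod (p ^ n i), IsUnit z →
      ‖F i z - kernelFun p j s ((z.val : ℕ) : ℤ_[p])‖ < ε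
    · exact ⟨1, isUnit_one, fun h' => absurd h h'⟩
    · have h' := h
      push Not at h'
      obtain ⟨z, hz, hz'⟩ := h'
      exact ⟨z, hz, fun _ => not_lt.mpr hz'⟩
  choose z hzu hz using hex
  have h1 : Tendsto (fun i => F i (z i)) U (𝓝 (kernelFun p j s (stY p U n (UProd.mk U z)))) :=
    inMonad_mk.mp (hF (UProd.mk U z) (mem_hyperUnits_mk.mpr (Eventually.of_forall hzu)))
  have h2 := h1.sub (tendsto_kernelFun_val (j := j) hp hs hn (Eventually.of_forall hzu))
  rw [sub_self] at h2
  have h3 := h2.norm.eventually (gt_mem_nhds (by rwa [norm_zero]))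
  obtain ⟨i, h4, h5⟩ := (hne.and h3).exists
  exact hz i h4 h5

lemma tendsto_altSum_comp {F : ℤ_[p] → ℂ_[p]} {v : ℂ_[p]} (h : Tendsto (altSum F) atTop (𝓝 v))
    (hn : IsInfiniteNat (UProd.mk U n)) : Tendsto (fun i => altSum F (n i)) U (𝓝 v) :=
  h.comp (tendsto_of_isInfiniteNat hn)

/-- The weights have norm `1`, so a uniform error in the lifting gives the same error in the sum,
however many terms there are. -/
lemma inMonad_hyperIntegral (hp : p ≠ 2) (hs : ‖s‖ < exponentRadius p)
    (hn : IsInfiniteNat (UProd.mk U n)) {v : ℂ_[p]}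
    (hv : Tendsto (altSum (kernelExt p j s)) atTop (𝓝 v))
    {F : UProd U (fun i => ZMod (p ^ n i) → ℂ_[p])}
    (hF : IsLiftOnUnits p U n (kernelFun p j s) F) :
    InMonad (hyperIntegral (hyperNu p U n) (hyperUnits p U n) F) v := by
  classical
  obtain ⟨F, rfl⟩ := UProd.exists_rep F
  have hmk : hyperIntegral (hyperNu p U n) (hyperUnits p U n) (UProd.mk U F) =
      UProd.mk U fun i => ∑ z : ZMod (p ^ n i) with IsUnit z, F i z * ((-1) ^ z.val / 2) :=
    UProd.mk_eq_mk.mpr (Eventually.of_forall fun i => Finset.sum_congr (by congr) fun _ _ => rfl)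
  rw [hmk, inMonad_mk]
  have h1 := tendsto_altSum_comp hv hn
  have h2 : Tendsto (fun i => (∑ z : ZMod (p ^ n i) with IsUnit z, F i z * ((-1) ^ z.val / 2)) -
      altSum (kernelExt p j s) (n i)) U (𝓝 0) := by
    rw [Metric.tendsto_nhds]
    intro ε hε
    filter_upwards [eventually_norm_lift_sub_lt hp hs hn hF (half_pos hε),
      eventually_le_of_isInfiniteNat hn 1] with i hi hi1
    refine lt_of_le_of_lt ?_ (half_lt_self hε)
    rw [dist_zero_right, altSum, Finset.sum_filter,
      ← sum_zmod_val (p ^ n i) (fun a => kernelExt p j s (a : ℤ_[p]) * ((-1) ^ a / 2)),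
      ← Finset.sum_sub_distrib]
    refine IsUltrametricDist.norm_sum_le_of_forall_le_of_nonneg (half_pos hε).le fun z _ => ?_
    split_ifs with hz
    · rw [kernelExt_of_isUnit ((isUnit_zmod_prime_pow_iff hi1 z).mp hz), ← sub_mul, norm_mul,
        norm_neg_one_pow_div_two hp, mul_one]
      exact (hi z hz).le
    · rw [kernelExt_of_not_isUnit (mt (isUnit_zmod_prime_pow_iff hi1 z).mpr hz), zero_mul, sub_zero,
        norm_zero]
      exact (half_pos hε).le
  simpa using h2.add h1

/-- The endpoints `0` and `p^k` are divisible by `p`, so it does not matter whether the index set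
contains them. This covers both the hyperfinite sum and the sums from `1` to `p^n`. -/
lemma sum_units_mul_eq_altSum {k : ℕ} (hk : 1 ≤ k) (s : Finset ℕ)
    (hs : ∀ m, ¬ p ∣ m → (m ∈ s ↔ m ≤ p ^ k)) (t : ℂ_[p]) :
    ∑ m ∈ s with ¬ p ∣ m, kernelFun p j t (m : ℤ_[p]) * ((-1) ^ m / 2) =
      altSum (kernelExt p j t) k := by
  have h1 : s.filter (fun m => ¬ p ∣ m) = (Finset.range (p ^ k)).filter (fun m => ¬ p ∣ m) := by
    ext m
    simp only [Finset.mem_filter, Finset.mem_range]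
    refine and_congr_left fun hm => ?_
    rw [hs m hm]
    refine ⟨fun h => lt_of_le_of_ne h ?_, le_of_lt⟩
    rintro rfl
    exact hm (dvd_pow_self p (by omega))
  rw [h1, Finset.sum_filter, altSum]
  refine Finset.sum_congr rfl fun m _ => ?_
  split_ifs with h
  · rw [kernelExt_of_not_isUnit, zero_mul]
    rwa [isUnit_natCast_iff, not_not]
  · rw [kernelExt_of_isUnit]
    rwa [isUnit_natCast_iff]

lemma inMonad_hyperSum_hyperRange (hn : IsInfiniteNat (UProd.mk U n)) {v : ℂ_[p]}
    (hv : Tendsto (altSum (kernelExt p j s)) atTop (𝓝 v)) :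
    InMonad (hyperSum (hyperRange p U n)
      (UProd.mk U (fun _ m => kernelFun p j s (m : ℤ_[p]) * ((-1) ^ m / 2)))) v := by
  refine inMonad_mk.mpr ((tendsto_altSum_comp hv hn).congr' ?_)
  filter_upwards [eventually_le_of_isInfiniteNat hn 1] with i hi
  exact (sum_units_mul_eq_altSum hi _ (fun m _ => by rw [Finset.mem_range, Nat.lt_succ_iff]) s).symm

end Hyperfinite

/-! ### The series and the values at integers -/

section Series

variable {p : ℕ} [Fact p.Prime] {j : ZMod (p - 1)} {s : ℂ_[p]}

variable (p) in
/-- The difference of the odd and the even part of the sum over `p^n ≤ m ≤ p^{n+1}`. -/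
def oddEvenTerm (j : ZMod (p - 1)) (s : ℂ_[p]) (n : ℕ) : ℂ_[p] :=
  (∑ m ∈ Finset.Icc (p ^ n) (p ^ (n + 1)) with ¬ p ∣ m ∧ Odd m, kernelFun p j s (m : ℤ_[p])) -
    ∑ m ∈ Finset.Icc (p ^ n) (p ^ (n + 1)) with ¬ p ∣ m ∧ Even m, kernelFun p j s (m : ℤ_[p])

lemma oddEvenTerm_eq (n : ℕ) :
    oddEvenTerm p j s n = -2 * ∑ m ∈ Finset.Icc (p ^ n) (p ^ (n + 1)),
      kernelExt p j s m * ((-1) ^ m / 2) := by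
  rw [oddEvenTerm, Finset.sum_filter, Finset.sum_filter, ← Finset.sum_sub_distrib, Finset.mul_sum]
  refine Finset.sum_congr rfl fun m _ => ?_
  by_cases h : p ∣ m
  · rw [kernelExt_of_not_isUnit (by rwa [isUnit_natCast_iff, not_not])]
    simp [h]
  · rw [kernelExt_of_isUnit (isUnit_natCast_iff.mpr h)]
    rcases Nat.even_or_odd m with hm | hm
    · rw [hm.neg_one_pow]
      simp [h, hm, Nat.not_odd_iff_even.mpr hm]
      ring
    · rw [hm.neg_one_pow]
      simp [h, hm, Nat.not_even_iff_odd.mpr hm]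
      ring

lemma kernelExt_prime_pow {k : ℕ} (hk : 1 ≤ k) : kernelExt p j s ((p ^ k : ℕ) : ℤ_[p]) = 0 :=
  kernelExt_of_not_isUnit (by rw [isUnit_natCast_iff, not_not]; exact dvd_pow_self p (by omega))

lemma altSum_kernelExt_zero : altSum (kernelExt p j s) 0 = 0 := by
  rw [altSum, pow_zero, Finset.sum_range_one, Nat.cast_zero, kernelExt_of_not_isUnit (by simp),
    zero_mul]

/-- The upper endpoint is a multiple of `p` and contributes nothing, so consecutive blocks overlap
harmlessly and the series telescopes. -/
lemma oddEvenTerm_eq_sub (n : ℕ) :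
    oddEvenTerm p j s n = -2 * (altSum (kernelExt p j s) (n + 1) - altSum (kernelExt p j s) n) := by
  have hle : p ^ n ≤ p ^ (n + 1) := Nat.pow_le_pow_right (Fact.out : p.Prime).pos n.le_succ
  rw [oddEvenTerm_eq, ← Finset.Ico_insert_right hle, Finset.sum_insert Finset.right_notMem_Ico,
    kernelExt_prime_pow (by omega), zero_mul, zero_add, Finset.sum_Ico_eq_sub _ hle, altSum, altSum]

lemma sum_range_oddEvenTerm (n : ℕ) :
    ∑ k ∈ Finset.range n, oddEvenTerm p j s k = -2 * altSum (kernelExt p j s) n := by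
  simp only [oddEvenTerm_eq_sub]
  rw [← Finset.mul_sum, Finset.sum_range_sub, altSum_kernelExt_zero, sub_zero]

lemma hasSum_oddEvenTerm {v : ℂ_[p]} (hv : Tendsto (altSum (kernelExt p j s)) atTop (𝓝 v)) :
    HasSum (oddEvenTerm p j s) (-2 * v) := by
  have h0 : Tendsto (oddEvenTerm p j s) atTop (𝓝 0) := by
    have := ((hv.comp (tendsto_add_atTop_nat 1)).sub hv).const_mul (-2)
    rw [sub_self, mul_zero] at this
    exact this.congr fun n => (oddEvenTerm_eq_sub n).symm
  -- In a complete non-Archimedean group, terms tending to `0` already give unconditional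
  -- summability.
  have hs : Summable (oddEvenTerm p j s) :=
    NonarchimedeanAddGroup.summable_of_tendsto_cofinite_zero (by rwa [Nat.cofinite_eq_atTop])
  have h1 := hs.hasSum.tendsto_sum_nat
  simp only [sum_range_oddEvenTerm] at h1
  rw [← tendsto_nhds_unique h1 (hv.const_mul (-2))]
  exact hs.hasSum

/-- The values of `ζ_{p,i}` at the integers `k ≡ i mod p - 1`. -/
lemma exists_tendsto_and_zeta_intCast (hp : p ≠ 2) {k : ℤ} (hk : k ≠ 1) :
    ∃ L : ℂ_[p],
      Tendsto (fun n : ℕ => ∑ m ∈ Finset.Icc 1 (p ^ n) with ¬ p ∣ m,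
        (-1) ^ m / 2 * (m : ℂ_[p]) ^ (-k)) atTop (𝓝 L) ∧
      zeta p (k : ZMod (p - 1)) (k : ℂ_[p]) = -1 / (1 - (2 : ℂ_[p]) ^ (1 - k)) * L := by
  have hs := norm_intCast_lt (p := p) hp k
  have h1 : (k : ℂ_[p]) ≠ 1 := by exact_mod_cast hk
  refine ⟨altLim p k k, (tendsto_altLim hp hs).congr' ?_, ?_⟩
  · filter_upwards [eventually_ge_atTop 1] with n hn
    rw [← sum_units_mul_eq_altSum hn (Finset.Icc 1 (p ^ n)) (fun m hm => ?_)]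
    · refine Finset.sum_congr rfl fun m hm => ?_
      have hu : IsUnit (m : ℤ_[p]) := isUnit_natCast_iff.mpr (Finset.mem_filter.mp hm).2
      rw [mul_comm, ← Int.cast_neg, ← Int.cast_neg, kernelFun_intCast hp hu, toCp_natCast]
    · rw [Finset.mem_Icc, and_iff_right_iff_imp]
      intro _
      exact Nat.one_le_iff_ne_zero.mpr fun h => hm (h ▸ dvd_zero p)
  · rw [zeta_eq hp hs (Or.inl h1), eulerTwo]
    -- On this branch `ω(2)^(1-k) ⟨2⟩^(1-k) = 2^(1-k)`, which turns `D` into `1 - 2^(1-k)`.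
    have h2 := kernelFun_intCast hp (isUnit_two hp) (1 - k)
    rw [Int.cast_sub, Int.cast_sub, Int.cast_one, Int.cast_one,
      show toCp p 2 = 2 from toCp_natCast 2] at h2
    rw [h2]

end Series

end PadicZeta

end

theorem mainTheorem8 (p : ℕ) [Fact p.Prime] (hp : p ≠ 2) :
    -- the regularized Bernoulli measure and its values on balls
    (PadicZeta.IsPadicMeasure (PadicZeta.regBernoulli p) ∧
      ∀ n a : ℕ, a < p ^ n →
        PadicZeta.regBernoulli p (PadicZeta.ball p (a : ℤ_[p]) n) = (-1) ^ a / 2) ∧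
    -- its hyperfinite representation
    (∀ (I : Type*) (U : Ultrafilter I) (n : I → ℕ),
      PadicZeta.IsInfiniteNat (PadicZeta.UProd.mk U n) →
      PadicZeta.IsPushDown p U n (PadicZeta.regBernoulli p) (PadicZeta.hyperNu p U n)) ∧
    -- the formulas for `ζ_{p,i}(s)`
    (∀ (i : ZMod (p - 1)) (s : ℂ_[p]),
      ‖s‖ < (p : ℝ) ^ (((p : ℝ) - 2) / ((p : ℝ) - 1)) →
      (s ≠ 1 ∨ PadicZeta.teich p 2 ^ (1 - i).val ≠ 1) →
      PadicZeta.eulerTwo p i s ≠ 0 ∧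
      -- as an integral with respect to the regularized Bernoulli measure
      (PadicZeta.PadicIntegrableOn (PadicZeta.regBernoulli p) {x : ℤ_[p] | IsUnit x}
          (PadicZeta.kernelFun p (-i) (-s)) ∧
        PadicZeta.zeta p i s = -1 / PadicZeta.eulerTwo p i s *
          PadicZeta.padicIntegralOn (PadicZeta.regBernoulli p) {x : ℤ_[p] | IsUnit x}
            (PadicZeta.kernelFun p (-i) (-s))) ∧
      -- as the standard part of a hyperfinite integral, resp. of a hyperfinite sum
      (∀ (I : Type*) (U : Ultrafilter I) (n : I → ℕ),
        PadicZeta.IsInfiniteNat (PadicZeta.UProd.mk U n) →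
        PadicZeta.IsLiftOnUnits p U n (PadicZeta.kernelFun p (-i) (-s))
          (PadicZeta.canonicalLift p U n (PadicZeta.kernelFun p (-i) (-s))) ∧
        (∀ F : PadicZeta.UProd U (fun j => ZMod (p ^ n j) → ℂ_[p]),
          PadicZeta.IsLiftOnUnits p U n (PadicZeta.kernelFun p (-i) (-s)) F →
          PadicZeta.IsNearstandard (PadicZeta.hyperIntegral (PadicZeta.hyperNu p U n)
            (PadicZeta.hyperUnits p U n) F) ∧
          PadicZeta.zeta p i s = -1 / PadicZeta.eulerTwo p i s *
            PadicZeta.st (PadicZeta.hyperIntegral (PadicZeta.hyperNu p U n)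
              (PadicZeta.hyperUnits p U n) F)) ∧
        (PadicZeta.IsNearstandard (PadicZeta.hyperSum (PadicZeta.hyperRange p U n)
            (PadicZeta.UProd.mk U
              (fun _ m => PadicZeta.kernelFun p (-i) (-s) (m : ℤ_[p]) * ((-1) ^ m / 2)))) ∧
          PadicZeta.zeta p i s = -1 / PadicZeta.eulerTwo p i s *
            PadicZeta.st (PadicZeta.hyperSum (PadicZeta.hyperRange p U n)
              (PadicZeta.UProd.mk U
                (fun _ m => PadicZeta.kernelFun p (-i) (-s) (m : ℤ_[p]) * ((-1) ^ m / 2)))))) ∧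
      -- as a convergent series
      (Summable (fun n : ℕ =>
          (∑ m ∈ Finset.Icc (p ^ n) (p ^ (n + 1)) with ¬ p ∣ m ∧ Odd m,
            PadicZeta.kernelFun p (-i) (-s) (m : ℤ_[p])) -
          ∑ m ∈ Finset.Icc (p ^ n) (p ^ (n + 1)) with ¬ p ∣ m ∧ Even m,
            PadicZeta.kernelFun p (-i) (-s) (m : ℤ_[p])) ∧
        PadicZeta.zeta p i s = 1 / (2 * PadicZeta.eulerTwo p i s) *
          ∑' n : ℕ,
            ((∑ m ∈ Finset.Icc (p ^ n) (p ^ (n + 1)) with ¬ p ∣ m ∧ Odd m,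
              PadicZeta.kernelFun p (-i) (-s) (m : ℤ_[p])) -
            ∑ m ∈ Finset.Icc (p ^ n) (p ^ (n + 1)) with ¬ p ∣ m ∧ Even m,
              PadicZeta.kernelFun p (-i) (-s) (m : ℤ_[p])))) ∧
    -- the values at integers `k ≠ 1`, on the branch `i = k mod (p - 1)`
    (∀ k : ℤ, k ≠ 1 →
      ∃ L : ℂ_[p],
        Tendsto (fun n : ℕ => ∑ m ∈ Finset.Icc 1 (p ^ n) with ¬ p ∣ m,
          (-1) ^ m / 2 * (m : ℂ_[p]) ^ (-k)) atTop (𝓝 L) ∧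
        PadicZeta.zeta p (k : ZMod (p - 1)) (k : ℂ_[p]) =
          -1 / (1 - (2 : ℂ_[p]) ^ (1 - k)) * L) := by
  refine ⟨⟨PadicZeta.isPadicMeasure_regBernoulli hp, fun n a ha => PadicZeta.regBernoulli_ball hp ha⟩,
    fun I U n hn => PadicZeta.isPushDown_regBernoulli hp hn, fun i s hs h => ?_,
    fun k hk => PadicZeta.exists_tendsto_and_zeta_intCast hp hk⟩
  have hs' : ‖-s‖ < PadicZeta.exponentRadius p := by rw [norm_neg]; exact hs
  have hlim := PadicZeta.tendsto_altLim (i := i) hp hs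
  have hz := PadicZeta.zeta_eq hp hs h
  have hD := PadicZeta.eulerTwo_ne_zero hp hs h
  refine ⟨hD, ⟨PadicZeta.padicIntegrableOn_kernelFun hp hs, ?_⟩,
    fun I U n hn => ⟨PadicZeta.isLiftOnUnits_canonicalLift hp hs' hn, fun F hF => ?_, ?_⟩, ?_⟩
  · rw [hz, PadicZeta.padicIntegralOn_kernelFun hp hs]
  · have hm := PadicZeta.inMonad_hyperIntegral hp hs' hn hlim hF
    exact ⟨⟨_, hm⟩, by rw [PadicZeta.st_eq hm, hz]⟩
  · have hm := PadicZeta.inMonad_hyperSum_hyperRange hn hlim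
    exact ⟨⟨_, hm⟩, by rw [PadicZeta.st_eq hm, hz]⟩
  · have hsum := PadicZeta.hasSum_oddEvenTerm hlim
    refine ⟨hsum.summable, ?_⟩
    have ht : _ = -2 * PadicZeta.altLim p i s := hsum.tsum_eq
    unfold PadicZeta.oddEvenTerm at ht
    rw [hz, ht]
    field_simp
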